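/- **Generic Equivalence Theorem.** Let $k$ be an algebraically closed field of infinite transcendence degree over its prime field. A $k$-variety is a reduced separated scheme of finite type over $k$ (not necessarily irreducible); all morphisms and isomorphisms are over $k$. Let $p\colon S\to Y$ and $q\colon T\to Y$ be affine morphisms of $k$-varieties. (1) Assume that for every closed point $y\in Y$ the schematic fibers $S_y=p^{-1}(y)$ and $T_y=q^{-1}(y)$ are isomorphic over $k$. Then there are a $k$-variety $U$, a dominant quasi-finite morphism $\varphi\colon U\to Y$, which is étale if $\operatorname{char} k=0$, and an isomorphism $S\times_Y U\simeq T\times_Y U$ over $U$. (2) Let $G$ be an algebraic group over $k$ (a group scheme of finite type over $k$) acting on $S$ and $T$ such that $p$ and $q$ are $G$-invariant; then $G$ acts on every $S\times_Y U$ and $T\times_Y U$ and on the fibers $S_y$ and $T_y$. Assume that for every closed point $y\in Y$ there is a $G$-equivariant isomorphism $S_y\simeq T_y$ over $k$. Then there are a $k$-variety $U$, a dominant quasi-finite morphism $\varphi\colon U\to Y$, which is étale if $\operatorname{char} k=0$, and a $G$-equivariant isomorphism $S\times_Y U\simeq T\times_Y U$ over $U$. -/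

import Mathlib

open CategoryTheory Limits MonoidalCategory CartesianMonoidalCategory MonObj AlgebraicGeometry

universe u

noncomputable section

namespace GenericEquivalence

/-- A scheme `X` over `Spec k` is a `k`-variety if it is reduced, separated and of finite type
over `k`. It need not be irreducible. -/
structure IsVariety {k : Type u} [Field k] (X : Over (Spec (.of k))) : Prop where
  isReduced : IsReduced X.left
  isSeparated : IsSeparated X.hom
  locallyOfFiniteType : LocallyOfFiniteType X.hom
  quasiCompact : QuasiCompact X.hom

variable {C : Type*} [Category* C] [CartesianMonoidalCategory C]

/-- `p : X ⟶ Y` is invariant under the action of `G` on `X`: `p (g • x) = p x`. -/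
def IsInvariant (G : C) [MonObj G] {X Y : C} [ModObj G X] (p : X ⟶ Y) : Prop :=
  γ[G, X] ≫ p = snd G X ≫ p

/-- If `p : X ⟶ Y` is invariant under the action of `G` on `X` and `f : U ⟶ Y` is arbitrary, this
is the induced action `g • (x, u) = (g • x, u)` of `G` on `X ×_Y U`. For `f` a point `y` of `Y`,
it is the induced action on the fiber of `p` over `y`. -/
def pullbackAct [HasPullbacks C] (G : C) [MonObj G] {X Y U : C} [ModObj G X] {p : X ⟶ Y}
    (hp : IsInvariant G p) (f : U ⟶ Y) : G ⊗ pullback p f ⟶ pullback p f :=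
  pullback.lift ((G ◁ pullback.fst p f) ≫ γ[G, X]) (snd G (pullback p f) ≫ pullback.snd p f) <| by
    have h : γ[G, X] ≫ p = snd G X ≫ p := hp
    simp [h, pullback.condition]

/-- A morphism `e : X ×_Y U ⟶ X' ×_Y U` is equivariant for the induced actions of `G`. -/
def IsEquivariant [HasPullbacks C] (G : C) [MonObj G] {X X' Y U : C} [ModObj G X] [ModObj G X']
    {p : X ⟶ Y} {q : X' ⟶ Y} (hp : IsInvariant G p) (hq : IsInvariant G q) {f : U ⟶ Y}
    (e : pullback p f ⟶ pullback q f) : Prop :=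
  pullbackAct G hp f ≫ e = (G ◁ e) ≫ pullbackAct G hq f

end GenericEquivalence

end

/-!
# Generic equivalence of affine families over a variety

Let `A` be the coordinate ring of an integral affine open subscheme of `Y` and let `Ω` be an
algebraic closure of its fraction field. The fibers of two families over the geometric generic point
`A → Ω` are isomorphic because the generic point becomes a closed point once the ground field is
shrunk. The families are defined by finitely many elements of `A`, hence over a finitely generated
subring `k₁` of `k`. Since `k` has infinite transcendence degree, it contains algebraically
independent elements over `k₁`, and they give a `k`-point `y` of `A` together with a field
homomorphism `τ : k → Ω`, not linear over `k`, such that `τ ∘ y` is the inclusion `A → Ω` on these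
finitely many elements (`exists_generic_point`). An isomorphism of the fibers over `y` is therefore
carried by `τ` to one over `Ω` (`exists_finset_becomeIso`). By finite presentation it is defined
over a finitely generated `A`-subalgebra of `Ω` (`BecomeIso.exists_fg`). Such a subalgebra is
quasi-finite over `A` after a denominator from `A` is inverted (`exists_quasiFinite_ge`), and in
characteristic zero it becomes étale after a further localization (`exists_etale_localization`).
This proves the affine statement `exists_becomeIso`. Over a general `Y`, one takes the disjoint
union of the schemes so obtained, one for each irreducible component of `Y`
(`exists_iso_of_isReduced`).

The same argument applies to families with a group action. The group `G` need not be affine, so it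
is replaced by an affine scheme `W` with a flat surjective morphism `W ⟶ G`. What has to be
transported is a diagram of affine families: `X`, the product `W × X`, the action map and the
projection `W × X ⟶ X`, and the function `W × X ⟶ W`, which is given by the coordinates of `W` as
marked elements (`ActionDiagram`, `ActionAlgebra`). An isomorphism of such diagrams is
`G`-equivariant because `W × X ⟶ G × X` is an epimorphism (`isEquivariant_of_iso`). The
non-equivariant statement is the case of the trivial group.
-/

namespace GenericEquivalence

/-! ### Generic points with values in the ground field -/

section FieldTheory

open Cardinal

/-- A field `K` embeds over `A₀` into an algebraically closed field whose transcendence degree over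
`A₀` is not smaller. -/
theorem exists_algHom_of_trdeg_le {A₀ K Ω : Type u} [CommRing A₀] [IsDomain A₀] [Field K]
    [Field Ω] [IsAlgClosed Ω] [Algebra A₀ K] [Algebra A₀ Ω] [FaithfulSMul A₀ K]
    [FaithfulSMul A₀ Ω] (h : Algebra.trdeg A₀ K ≤ Algebra.trdeg A₀ Ω) :
    Nonempty (K →ₐ[A₀] Ω) := by
  obtain ⟨s, hs⟩ := exists_isTranscendenceBasis A₀ K
  obtain ⟨r, hr⟩ := exists_isTranscendenceBasis A₀ Ω
  rw [← hs.cardinalMk_eq_trdeg, ← hr.cardinalMk_eq_trdeg] at h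
  obtain ⟨i⟩ := h
  have hi : AlgebraicIndependent A₀ (fun x : s => (i x : Ω)) := hr.1.comp i i.injective
  let v : Algebra.adjoin A₀ (Set.range ((↑) : s → K)) →ₐ[A₀] Ω :=
    (MvPolynomial.aeval fun x : s => (i x : Ω)).comp hs.1.aevalEquiv.symm.toAlgHom
  have hv : Function.Injective v :=
    Function.Injective.comp (g := MvPolynomial.aeval fun x : s => (i x : Ω)) hi
      hs.1.aevalEquiv.symm.injective
  let _ : Algebra (Algebra.adjoin A₀ (Set.range ((↑) : s → K))) Ω := v.toRingHom.toAlgebra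
  have : FaithfulSMul (Algebra.adjoin A₀ (Set.range ((↑) : s → K))) Ω :=
    (faithfulSMul_iff_algebraMap_injective _ _).2 hv
  have := hs.isAlgebraic
  have : IsScalarTower A₀ (Algebra.adjoin A₀ (Set.range ((↑) : s → K))) Ω :=
    .of_algebraMap_eq fun x => (v.commutes x).symm
  exact ⟨(IsAlgClosed.lift :
    K →ₐ[Algebra.adjoin A₀ (Set.range ((↑) : s → K))] Ω).restrictScalars A₀⟩

/-- Enlarging the base by a ring of finite transcendence degree does not affect an infinite
transcendence degree. -/
theorem trdeg_eq_of_lt_aleph0 {F A₀ K : Type u} [Field F] [CommRing A₀] [Field K]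
    [Algebra F A₀] [Algebra F K] [Algebra A₀ K] [IsScalarTower F A₀ K]
    [Nontrivial A₀] [FaithfulSMul A₀ K]
    (h₀ : Algebra.trdeg F A₀ < ℵ₀) (hK : ℵ₀ ≤ Algebra.trdeg F K) :
    Algebra.trdeg A₀ K = Algebra.trdeg F K := by
  have h := trdeg_add_eq F A₀ (A := K)
  rw [← h]
  symm
  refine Cardinal.add_eq_right ?_ ?_
  · by_contra! hlt
    exact (Cardinal.add_lt_aleph0 h₀ hlt).not_ge (h ▸ hK)
  · by_contra! hlt
    exact (Cardinal.add_lt_aleph0 h₀ (hlt.trans h₀)).not_ge (h ▸ hK)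

/-- A `k`-point of `k[X]` extends along an integral extension when `k` is algebraically closed. -/
theorem exists_algHom_extending {k P A : Type u} [Field k] [IsAlgClosed k] [CommRing P]
    [CommRing A] [Algebra k P] [Algebra k A] [Algebra.FiniteType k A] (g : P →ₐ[k] A)
    (hg : Function.Injective g) (hint : g.IsIntegral) (y₀ : P →ₐ[k] k) :
    ∃ y : A →ₐ[k] k, ∀ x, y (g x) = y₀ x := by
  let _ := g.toRingHom.toAlgebra
  have : Algebra.IsIntegral P A := ⟨hint⟩
  have hmax : (RingHom.ker y₀).IsMaximal :=
    RingHom.ker_isMaximal_of_surjective y₀ fun x => ⟨algebraMap k P x, y₀.commutes x⟩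
  obtain ⟨Q, hQ, hQc⟩ := Ideal.exists_ideal_over_maximal_of_isIntegral (S := A) (RingHom.ker y₀)
    (by
      rw [(RingHom.injective_iff_ker_eq_bot (algebraMap P A)).1 hg]
      exact bot_le)
  let _ := Ideal.Quotient.field Q
  have : Module.Finite k (A ⧸ Q) := finite_of_finite_type_of_isJacobsonRing k (A ⧸ Q)
  have hbij := IsAlgClosed.algebraMap_bijective_of_isIntegral (k := k) (K := A ⧸ Q)
  let ε : k ≃ₐ[k] (A ⧸ Q) := AlgEquiv.ofBijective (Algebra.ofId k (A ⧸ Q)) hbij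
  refine ⟨ε.symm.toAlgHom.comp (Ideal.Quotient.mkₐ k Q), fun x => ?_⟩
  have hx : x - algebraMap k P (y₀ x) ∈ Q.comap (algebraMap P A) := by
    rw [hQc, RingHom.mem_ker, map_sub, AlgHom.commutes]
    simp
  have hx' : Ideal.Quotient.mk Q (g x) = algebraMap k (A ⧸ Q) (y₀ x) := by
    have h2 : g (x - algebraMap k P (y₀ x)) ∈ Q := hx
    rw [map_sub, AlgHom.commutes, ← Ideal.Quotient.mk_eq_mk_iff_sub_mem] at h2
    exact h2
  change ε.symm (Ideal.Quotient.mk Q (g x)) = _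
  rw [hx']
  exact ε.symm_apply_apply (y₀ x)

/-- Elements integral over `P[X]` are integral over `P₁[X]` for a subring `P₁` of `P` containing
the coefficients of their equations. -/
theorem exists_finset_isIntegral {σ F k A : Type*} [CommRing F] [Field k] [Algebra F k]
    [CommRing A] (g : MvPolynomial σ k →+* A) (hint : g.IsIntegral) (t : Finset A) :
    ∃ c : Finset k, ∀ k₁ : Subalgebra F k, (c : Set k) ⊆ k₁ →
      ∀ a ∈ t, (g.comp (MvPolynomial.map (algebraMap k₁ k))).IsIntegralElem a := by
  classical
  choose f hf using fun a => hint a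
  refine ⟨t.biUnion fun a => (f a).support.biUnion fun i =>
    ((f a).coeff i).support.image fun m => ((f a).coeff i).coeff m, fun k₁ hk a ha => ?_⟩
  have hmem : f a ∈ Polynomial.lifts (MvPolynomial.map (σ := σ) (algebraMap k₁ k)) := by
    rw [Polynomial.lifts_iff_coeff_lifts]
    intro i
    refine MvPolynomial.mem_range_map_iff_coeffs_subset.2 ?_
    intro x hx
    rw [Finset.mem_coe, MvPolynomial.mem_coeffs_iff] at hx
    obtain ⟨m, hm, rfl⟩ := hx
    have h1 : ((f a).coeff i).coeff m ∈ k₁ := hk (by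
      simp only [Finset.coe_biUnion, Set.mem_iUnion, Finset.mem_coe, Finset.mem_image]
      refine ⟨a, ha, i, ?_, m, hm, rfl⟩
      rw [Polynomial.mem_support_iff]
      rintro h0
      simp [h0] at hm)
    exact ⟨⟨_, h1⟩, rfl⟩
  obtain ⟨q, hq, -, hqm⟩ := Polynomial.lifts_and_natDegree_eq_and_monic hmem (hf a).1
  refine ⟨q, hqm, ?_⟩
  rw [← Polynomial.eval₂_map, hq]
  exact (hf a).2

/-- Let `A` be a finitely generated domain over an algebraically closed field `k` of infinite
transcendence degree. Over a finitely generated field of definition the generic point of `Spec A`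
becomes a `k`-point: given finitely many elements of `A`, some `k`-point `y` of `A` agrees on them
with a given embedding of `A` into an algebraically closed field, up to a field homomorphism `τ`
that is not `k`-linear. -/
theorem exists_generic_point {F k : Type u} [Field F] [Field k] [Algebra F k] [IsAlgClosed k]
    (hk : Cardinal.aleph0 ≤ Algebra.trdeg F k)
    {A Ω : Type u} [CommRing A] [IsDomain A] [Algebra k A] [Algebra.FiniteType k A]
    [Field Ω] [IsAlgClosed Ω] [Algebra A Ω] [FaithfulSMul A Ω] (t : Finset A) :
    ∃ (y : A →ₐ[k] k) (τ : k →+* Ω), ∀ a ∈ t, τ (y a) = algebraMap A Ω a := by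
  obtain ⟨n, g, hg, hint⟩ := exists_integral_inj_algHom_of_fg k A
  obtain ⟨c, hc⟩ := exists_finset_isIntegral (F := F) g.toRingHom hint t
  obtain ⟨k₁, hfin, hck⟩ : ∃ k₁ : Subalgebra F k, Algebra.FiniteType F k₁ ∧ (c : Set k) ⊆ k₁ :=
    ⟨Algebra.adjoin F (c : Set k),
      (Subalgebra.fg_iff_finiteType _).1 (Subalgebra.fg_adjoin_finset c), Algebra.subset_adjoin⟩
  -- `A` is integral over `k[X]`, and the elements of `t` are already integral over `k₁[X]` for a
  -- finitely generated algebra `k₁`; the integral closure `A₀` contains them.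
  replace hc := hc k₁ hck
  let g₁ : MvPolynomial (Fin n) k₁ →+* A :=
    g.toRingHom.comp (MvPolynomial.map (algebraMap k₁ k))
  have hg₁ : Function.Injective g₁ :=
    hg.comp (MvPolynomial.map_injective _ Subtype.val_injective)
  let _ : Algebra (MvPolynomial (Fin n) k₁) A := g₁.toAlgebra
  let A₀ := integralClosure (MvPolynomial (Fin n) k₁) A
  -- The point `y` has coordinates which are algebraically independent over `k₁`.
  have htr : Algebra.trdeg k₁ k = Algebra.trdeg F k :=
    trdeg_eq_of_lt_aleph0 trdeg_lt_aleph0_of_finiteType hk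
  obtain ⟨b, hb⟩ := exists_isTranscendenceBasis k₁ k
  have hbc : Cardinal.aleph0 ≤ Cardinal.mk b := by
    rw [hb.cardinalMk_eq_trdeg, htr]; exact hk
  have hinf : Infinite b := Cardinal.infinite_iff.2 hbc
  let i : Fin n ↪ b := Fin.valEmbedding.trans (Infinite.natEmbedding b)
  have hx : AlgebraicIndependent k₁ (fun j => (i j : k)) := hb.1.comp i i.injective
  obtain ⟨y, hy⟩ := exists_algHom_extending g hg hint (MvPolynomial.aeval fun j => (i j : k))
  have hyg : ∀ p, y (g₁ p) = MvPolynomial.aeval (fun j => (i j : k)) p := by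
    intro p
    change y (g (MvPolynomial.map (algebraMap k₁ k) p)) = _
    rw [hy, MvPolynomial.aeval_map_algebraMap]
  -- Hence `y` is injective on `k₁[X]`, and on the domain `A₀`, which is integral over it.
  let y₀ : A₀ →+* k := y.toRingHom.comp A₀.val.toRingHom
  have hy₀ : Function.Injective y₀ := by
    rw [RingHom.injective_iff_ker_eq_bot]
    have : Algebra.IsIntegral (MvPolynomial (Fin n) k₁) A₀ := integralClosure.AlgebraIsIntegral
    refine Ideal.eq_bot_of_comap_eq_bot (R := MvPolynomial (Fin n) k₁) (S := A₀) ?_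
    rw [RingHom.comap_ker, ← RingHom.injective_iff_ker_eq_bot]
    intro p q hpq
    exact hx (((hyg p).symm.trans hpq).trans (hyg q))
  let _ : Algebra A₀ k := y₀.toAlgebra
  have : FaithfulSMul A₀ k := (faithfulSMul_iff_algebraMap_injective _ _).2 hy₀
  have : FaithfulSMul A₀ Ω := (faithfulSMul_iff_algebraMap_injective _ _).2
    ((FaithfulSMul.algebraMap_injective A Ω).comp Subtype.val_injective)
  let _ : Algebra F A₀ :=
    ((algebraMap (MvPolynomial (Fin n) k₁) A₀).comp (algebraMap F _)).toAlgebra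
  have : IsScalarTower F (MvPolynomial (Fin n) k₁) A₀ := .of_algebraMap_eq fun _ => rfl
  have : IsScalarTower F A₀ k := .of_algebraMap_eq fun x => by
    change _ = y (g₁ (algebraMap F (MvPolynomial (Fin n) k₁) x))
    rw [hyg, IsScalarTower.algebraMap_apply F k₁ (MvPolynomial (Fin n) k₁),
      AlgHom.commutes]
    rfl
  let _ : Algebra F Ω := ((algebraMap A₀ Ω).comp (algebraMap F A₀)).toAlgebra
  have : IsScalarTower F A₀ Ω := .of_algebraMap_eq fun _ => rfl
  have : FaithfulSMul (MvPolynomial (Fin n) k₁) A₀ :=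
    (faithfulSMul_iff_algebraMap_injective _ _).2 fun p q hpq =>
      hg₁ (congrArg Subtype.val hpq)
  have hA₀ : Algebra.trdeg F A₀ < Cardinal.aleph0 := by
    rw [← trdeg_add_eq F (MvPolynomial (Fin n) k₁) (A := A₀),
      trdeg_eq_zero (R := MvPolynomial (Fin n) k₁), add_zero]
    exact trdeg_lt_aleph0_of_finiteType
  have hle : Algebra.trdeg F k ≤ Algebra.trdeg F Ω := by
    let j : k →ₐ[F] Ω :=
      { (algebraMap A Ω).comp (algebraMap k A) with
        commutes' := fun x => by
          change algebraMap A Ω (algebraMap k A (algebraMap F k x)) =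
            algebraMap A Ω (g₁ (algebraMap F (MvPolynomial (Fin n) k₁) x))
          congr 1
          rw [IsScalarTower.algebraMap_apply F k₁ (MvPolynomial (Fin n) k₁)]
          change _ = g (MvPolynomial.map (algebraMap k₁ k) (MvPolynomial.C _))
          rw [MvPolynomial.map_C]
          exact (g.commutes (algebraMap F k x)).symm }
    exact trdeg_le_of_injective j j.toRingHom.injective
  -- Both `k`, via `y`, and `Ω` contain `A₀`, which has finite transcendence degree.
  obtain ⟨τ⟩ := exists_algHom_of_trdeg_le (A₀ := A₀) (K := k) (Ω := Ω) (by
    rw [trdeg_eq_of_lt_aleph0 hA₀ hk, trdeg_eq_of_lt_aleph0 hA₀ (hk.trans hle)]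
    exact hle)
  exact ⟨y, τ.toRingHom, fun a ha => τ.commutes ⟨a, hc a ha⟩⟩

end FieldTheory

/-! ### Change of the base ring of a pair of algebras -/

section BaseChange

open scoped TensorProduct
open Algebra.TensorProduct

variable {A B C D D' E : Type u} [CommRing A] [CommRing B] [CommRing C] [CommRing D] [CommRing D']
  [CommRing E] [Algebra A B] [Algebra A C] [Algebra A D] [Algebra A D']

/-- The ring homomorphism out of `D ⊗[A] B` given by ring homomorphisms out of `D` and `B` which
agree on `A`; the target is not required to be an `A`-algebra. -/
noncomputable def tensorLift (f : D →+* E) (g : B →+* E)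
    (h : f.comp (algebraMap A D) = g.comp (algebraMap A B)) : D ⊗[A] B →+* E :=
  let _ : Algebra A E := (f.comp (algebraMap A D)).toAlgebra
  (lift (R := A) (S := A) (⟨f, fun _ => rfl⟩ : D →ₐ[A] E)
    (⟨g, fun x => (RingHom.congr_fun h x).symm⟩ : B →ₐ[A] E) fun _ _ => .all _ _).toRingHom

@[simp]
theorem tensorLift_tmul (f : D →+* E) (g : B →+* E)
    (h : f.comp (algebraMap A D) = g.comp (algebraMap A B)) (d : D) (b : B) :
    tensorLift f g h (d ⊗ₜ b) = f d * g b := by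
  let _ : Algebra A E := (f.comp (algebraMap A D)).toAlgebra
  exact lift_tmul ..

theorem tensor_ringHom_ext {f g : D ⊗[A] B →+* E} (hl : ∀ d : D, f (d ⊗ₜ 1) = g (d ⊗ₜ 1))
    (hr : ∀ b : B, f (1 ⊗ₜ b) = g (1 ⊗ₜ b)) : f = g := by
  ext x
  · exact hl x
  · exact hr x

/-- Ring homomorphisms out of an `A`-algebra which agree on `A` and on a set of generators are
equal. -/
theorem ringHom_ext_of_adjoin_eq_top {s : Set B} (hs : Algebra.adjoin A s = ⊤) {f g : B →+* E}
    (hA : ∀ a, f (algebraMap A B a) = g (algebraMap A B a)) (h : ∀ x ∈ s, f x = g x) : f = g := by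
  ext b
  have hb : b ∈ Algebra.adjoin A s := hs ▸ Algebra.mem_top
  induction hb using Algebra.adjoin_induction with
  | mem x hx => exact h x hx
  | algebraMap r => exact hA r
  | add x y _ _ hx hy => rw [map_add, map_add, hx, hy]
  | mul x y _ _ hx hy => rw [map_mul, map_mul, hx, hy]

/-- The `D`-linear extension of a homomorphism from `B` to `D ⊗[A] C`. -/
noncomputable def extend (φ : B →ₐ[A] D ⊗[A] C) : D ⊗[A] B →ₐ[D] D ⊗[A] C :=
  lift (Algebra.ofId D (D ⊗[A] C)) φ fun _ _ => .all _ _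

@[simp]
theorem extend_tmul (φ : B →ₐ[A] D ⊗[A] C) (d : D) (b : B) :
    extend φ (d ⊗ₜ b) = d ⊗ₜ 1 * φ b := lift_tmul ..

theorem extend_one_tmul (φ : B →ₐ[A] D ⊗[A] C) (b : B) : extend φ (1 ⊗ₜ b) = φ b := by
  rw [extend_tmul, ← Algebra.TensorProduct.one_def, _root_.one_mul]

/-- Base change of `B` along `D → D'`. -/
noncomputable abbrev push (B : Type u) [CommRing B] [Algebra A B] (j : D →ₐ[A] D') :
    D ⊗[A] B →ₐ[A] D' ⊗[A] B :=
  map j (AlgHom.id A B)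

theorem extend_push (j : D →ₐ[A] D') (φ : B →ₐ[A] D ⊗[A] C) (z : D ⊗[A] B) :
    extend ((push C j).comp φ) (push B j z) = push C j (extend φ z) := by
  have := tensor_ringHom_ext (A := A)
    (f := (extend ((push C j).comp φ)).toRingHom.comp (push B j).toRingHom)
    (g := (push C j).toRingHom.comp (extend φ).toRingHom) (by simp) (by simp)
  exact RingHom.congr_fun this z

end BaseChange

/-! ### Diagrams of algebras and their isomorphisms after base change -/

section Solutions

open scoped TensorProduct
open Algebra.TensorProduct

/-- A pair of algebras `B`, `M` over `A` with two homomorphisms `a, s : B → M` and marked elements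
of `M`. In geometric terms `M` is the ring of functions on `W × X`, where `X = Spec B`, the
homomorphisms are given by an action map and by the projection to `X`, and the marked elements are
coordinates on `W`. -/
structure ActionAlgebra (A : Type u) [CommRing A] (κ : Type*) where
  (B M : Type u)
  [ringB : CommRing B]
  [ringM : CommRing M]
  [algB : Algebra A B]
  [algM : Algebra A M]
  [presB : Algebra.FinitePresentation A B]
  [presM : Algebra.FinitePresentation A M]
  (a s : B →ₐ[A] M)
  mark : κ → M

attribute [instance] ActionAlgebra.ringB ActionAlgebra.ringM ActionAlgebra.algB ActionAlgebra.algM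
  ActionAlgebra.presB ActionAlgebra.presM

variable {A : Type u} [CommRing A] {κ : Type*} (X X' : ActionAlgebra A κ)

/-- Homomorphisms `X.B → D ⊗ X'.B` and `X.M → D ⊗ X'.M` compatible with the structure maps and the
marked elements. -/
structure BaseChangeHom (D : Type u) [CommRing D] [Algebra A D] where
  φ : X.B →ₐ[A] D ⊗[A] X'.B
  Φ : X.M →ₐ[A] D ⊗[A] X'.M
  comp_a : ∀ b, Φ (X.a b) = map (.id A D) X'.a (φ b)
  comp_s : ∀ b, Φ (X.s b) = map (.id A D) X'.s (φ b)
  comp_mark : ∀ i, Φ (X.mark i) = 1 ⊗ₜ X'.mark i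

/-- `X` and `X'` become isomorphic over the `A`-algebra `D`. -/
def BecomeIso (D : Type u) [CommRing D] [Algebra A D] : Prop :=
  ∃ (f : BaseChangeHom X X' D) (g : BaseChangeHom X' X D),
    (∀ b, extend g.φ (f.φ b) = 1 ⊗ₜ b) ∧ (∀ b, extend f.φ (g.φ b) = 1 ⊗ₜ b) ∧
    (∀ b, extend g.Φ (f.Φ b) = 1 ⊗ₜ b) ∧ (∀ b, extend f.Φ (g.Φ b) = 1 ⊗ₜ b)

end Solutions

section Transport

open scoped TensorProduct
open Algebra.TensorProduct

variable {A B C : Type u} [CommRing A] [CommRing B] [CommRing C] [Algebra A B] [Algebra A C]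

/-- A finite set of elements can be completed to a finite set of generators. -/
theorem exists_finset_adjoin_eq_top [Algebra.FiniteType A B] (r : Set B) (hr : r.Finite) :
    ∃ s : Finset B, r ⊆ s ∧ Algebra.adjoin A (s : Set B) = ⊤ := by
  classical
  obtain ⟨s, hs⟩ := (inferInstance : Algebra.FiniteType A B).out
  refine ⟨hr.toFinset ∪ s, fun x hx => by simp [hx], top_le_iff.1 (hs ▸ Algebra.adjoin_mono ?_)⟩
  intro x hx
  simp [Finset.mem_coe.1 hx]

/-- Let `B` be finitely presented over `A` with generators `s`. The structure map `A → E` of a ring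
homomorphism `B → E` can be changed without changing the images of the generators, as long as the
coefficients of the relations keep their images. -/
theorem exists_finset_ringHom_change [Algebra.FinitePresentation A B] (s : Finset B)
    (hs : Algebra.adjoin A (s : Set B) = ⊤) :
    ∃ t : Finset A, ∀ {E : Type u} [CommRing E] (h : B →+* E) (α : A →+* E),
      (∀ a ∈ t, h (algebraMap A B a) = α a) →
      ∃ h' : B →+* E, (∀ a, h' (algebraMap A B a) = α a) ∧ ∀ x ∈ s, h' x = h x := by
  classical
  let f : MvPolynomial s A →ₐ[A] B := MvPolynomial.aeval Subtype.val
  have hf : Function.Surjective f := by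
    rw [← AlgHom.range_eq_top, ← hs, Algebra.adjoin_eq_range]
    rfl
  obtain ⟨r, hr⟩ := Algebra.FinitePresentation.ker_fG_of_surjective f hf
  refine ⟨r.biUnion fun p => p.support.image p.coeff, fun {E} _ h α hα => ?_⟩
  let g : MvPolynomial s A →+* E := MvPolynomial.eval₂Hom α fun x => h x
  have hg : ∀ p ∈ RingHom.ker f.toRingHom, g p = 0 := by
    intro p hp
    rw [← hr] at hp
    change p ∈ RingHom.ker g
    refine (Ideal.span_le (I := RingHom.ker g)).2 (fun q hq => ?_) hp
    have hq0 : f q = 0 := by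
      have : q ∈ RingHom.ker f.toRingHom := hr ▸ Ideal.subset_span hq
      exact this
    change MvPolynomial.eval₂ α (fun x : s => h x) q = 0
    rw [← map_zero h, ← hq0]
    change _ = h (MvPolynomial.eval₂ (algebraMap A B) Subtype.val q)
    rw [MvPolynomial.hom_eval₂, MvPolynomial.eval₂_eq, MvPolynomial.eval₂_eq]
    refine Finset.sum_congr rfl fun m hm => ?_
    congr 1
    exact (hα _ (Finset.mem_biUnion.2 ⟨q, hq, Finset.mem_image_of_mem _ hm⟩)).symm
  let h' : B →+* E := RingHom.liftOfSurjective f.toRingHom hf ⟨g, hg⟩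
  have hh' : ∀ p, h' (f p) = g p := fun p =>
    RingHom.liftOfRightInverse_comp_apply _ _ (Function.rightInverse_surjInv hf) ⟨g, hg⟩ p
  refine ⟨h', fun a => ?_, fun x hx => ?_⟩
  · rw [← f.commutes a, hh']
    exact MvPolynomial.eval₂_C ..
  · have : f (MvPolynomial.X ⟨x, hx⟩) = x := MvPolynomial.aeval_X ..
    conv_lhs => rw [← this]
    rw [hh']
    exact MvPolynomial.eval₂_X ..

/-- `t` contains the coefficients of the relations between the generators `s` of `B`. This is
expressed by its consequence `exists_finset_ringHom_change`, so that no presentation is chosen. -/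
def ContainsCoeffs (s : Finset B) (t : Finset A) : Prop :=
  ∀ {E : Type u} [CommRing E] (h : B →+* E) (α : A →+* E),
    (∀ a ∈ t, h (algebraMap A B a) = α a) →
    ∃ h' : B →+* E, (∀ a, h' (algebraMap A B a) = α a) ∧ ∀ x ∈ s, h' x = h x

theorem ContainsCoeffs.mono {s : Finset B} {t t' : Finset A} (h : ContainsCoeffs s t)
    (ht : t ⊆ t') : ContainsCoeffs s t' :=
  fun f α hα => h f α fun a ha => hα a (ht ha)

variable {D₁ D₂ : Type u} [CommRing D₁] [CommRing D₂] [Algebra A D₁] [Algebra A D₂]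

/-- A ring homomorphism `D₁ → D₂` which is compatible with the structure maps from `A` only on the
coefficients of the relations of `B` still induces a homomorphism `D₁ ⊗ B → D₂ ⊗ B`. -/
theorem ContainsCoeffs.exists_tensor {s : Finset B} {t : Finset A} (hst : ContainsCoeffs s t)
    (τ : D₁ →+* D₂) (hτ : ∀ a ∈ t, τ (algebraMap A D₁ a) = algebraMap A D₂ a) :
    ∃ θ : D₁ ⊗[A] B →+* D₂ ⊗[A] B, (∀ d, θ (d ⊗ₜ 1) = τ d ⊗ₜ 1) ∧
      ∀ x ∈ s, θ (1 ⊗ₜ x) = 1 ⊗ₜ x := by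
  let α : A →+* D₂ ⊗[A] B :=
    (algebraMap D₂ (D₂ ⊗[A] B)).comp (τ.comp (algebraMap A D₁))
  obtain ⟨h', hA, hx⟩ := hst (includeRight : B →ₐ[A] D₂ ⊗[A] B).toRingHom α fun a ha => by
    change includeRight (algebraMap A B a) = τ (algebraMap A D₁ a) ⊗ₜ 1
    rw [hτ a ha, AlgHom.commutes]
    rfl
  refine ⟨tensorLift ((algebraMap D₂ (D₂ ⊗[A] B)).comp τ) h' ?_, fun d => ?_, fun x hxs => ?_⟩
  · ext a
    exact (hA a).symm
  · rw [tensorLift_tmul, map_one, _root_.mul_one]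
    rfl
  · rw [tensorLift_tmul, map_one, _root_.one_mul, hx x hxs]
    rfl

/-- Transport of a homomorphism along a ring homomorphism `D₁ → D₂` which is compatible with the
structure maps from `A` only on finitely many elements. -/
theorem ContainsCoeffs.exists_algHom {s : Finset B} {t : Finset A} (hst : ContainsCoeffs s t)
    (τ : D₁ →+* D₂) (hτ : ∀ a ∈ t, τ (algebraMap A D₁ a) = algebraMap A D₂ a)
    (θ : D₁ ⊗[A] C →+* D₂ ⊗[A] C) (hθ : ∀ d, θ (d ⊗ₜ 1) = τ d ⊗ₜ 1)
    (φ : B →ₐ[A] D₁ ⊗[A] C) :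
    ∃ φ' : B →ₐ[A] D₂ ⊗[A] C, ∀ x ∈ s, φ' x = θ (φ x) := by
  obtain ⟨h', hA, hx⟩ := hst (θ.comp φ.toRingHom) (algebraMap A (D₂ ⊗[A] C)) fun a ha => by
    change θ (φ (algebraMap A B a)) = _
    rw [φ.commutes, Algebra.TensorProduct.algebraMap_apply, hθ, hτ a ha,
      Algebra.TensorProduct.algebraMap_apply]
  exact ⟨⟨h', hA⟩, hx⟩

/-- The transport homomorphisms commute with the linear extensions of `φ` and of its transport
`φ'`. -/
theorem extend_transport {s : Finset B} (hs : Algebra.adjoin A (s : Set B) = ⊤) {τ : D₁ →+* D₂}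
    {θB : D₁ ⊗[A] B →+* D₂ ⊗[A] B} (hB : ∀ d, θB (d ⊗ₜ 1) = τ d ⊗ₜ 1)
    (hBs : ∀ x ∈ s, θB (1 ⊗ₜ x) = 1 ⊗ₜ x)
    {θC : D₁ ⊗[A] C →+* D₂ ⊗[A] C} (hC : ∀ d, θC (d ⊗ₜ 1) = τ d ⊗ₜ 1)
    {φ : B →ₐ[A] D₁ ⊗[A] C} {φ' : B →ₐ[A] D₂ ⊗[A] C} (hφ : ∀ x ∈ s, φ' x = θC (φ x))
    (z : D₁ ⊗[A] B) : extend φ' (θB z) = θC (extend φ z) := by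
  suffices h : (extend φ').toRingHom.comp θB = θC.comp (extend φ).toRingHom from
    RingHom.congr_fun h z
  have hD (d : D₁) : extend φ' (θB (d ⊗ₜ 1)) = θC (extend φ (d ⊗ₜ 1)) := by
    rw [hB, extend_tmul, extend_tmul, map_one, map_one, _root_.mul_one, _root_.mul_one, hC]
  refine tensor_ringHom_ext hD fun b => ?_
  refine RingHom.congr_fun (f := ((extend φ').toRingHom.comp θB).comp
    (includeRight : B →ₐ[A] D₁ ⊗[A] B).toRingHom) (g := (θC.comp (extend φ).toRingHom).comp
    (includeRight : B →ₐ[A] D₁ ⊗[A] B).toRingHom)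
    (ringHom_ext_of_adjoin_eq_top hs (fun a => ?_) fun x hx => ?_) b
  · change extend φ' (θB (1 ⊗ₜ algebraMap A B a)) = θC (extend φ (1 ⊗ₜ algebraMap A B a))
    have : (1 : D₁) ⊗ₜ[A] algebraMap A B a = algebraMap A D₁ a ⊗ₜ 1 := by
      rw [← Algebra.TensorProduct.algebraMap_apply, ← Algebra.TensorProduct.algebraMap_apply']
    rw [this, hD]
  · change extend φ' (θB (1 ⊗ₜ x)) = θC (extend φ (1 ⊗ₜ x))
    rw [hBs x hx, extend_one_tmul, extend_one_tmul, hφ x hx]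

end Transport

section TransportDiagrams

open scoped TensorProduct
open Algebra.TensorProduct

variable {A : Type u} [CommRing A] {κ : Type*}

/-- Generators of the two algebras of a diagram, stable under the structure maps. -/
structure ActionAlgebra.Generators (X : ActionAlgebra A κ) where
  sB : Finset X.B
  sM : Finset X.M
  adjoin_sB : Algebra.adjoin A (sB : Set X.B) = ⊤
  adjoin_sM : Algebra.adjoin A (sM : Set X.M) = ⊤
  a_mem : ∀ x ∈ sB, X.a x ∈ sM
  s_mem : ∀ x ∈ sB, X.s x ∈ sM
  mark_mem : ∀ i, X.mark i ∈ sM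

theorem ActionAlgebra.nonempty_generators [Finite κ] (X : ActionAlgebra A κ) :
    Nonempty X.Generators := by
  obtain ⟨sB, -, hB⟩ := exists_finset_adjoin_eq_top (A := A) (∅ : Set X.B) Set.finite_empty
  obtain ⟨sM, hr, hM⟩ := exists_finset_adjoin_eq_top (A := A)
    (X.a '' sB ∪ X.s '' sB ∪ Set.range X.mark)
    (((sB.finite_toSet.image _).union (sB.finite_toSet.image _)).union (Set.finite_range _))
  exact ⟨⟨sB, sM, hB, hM, fun x hx => hr (.inl (.inl ⟨x, hx, rfl⟩)),
    fun x hx => hr (.inl (.inr ⟨x, hx, rfl⟩)), fun i => hr (.inr ⟨i, rfl⟩)⟩⟩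

variable {D₁ D₂ : Type u} [CommRing D₁] [CommRing D₂] [Algebra A D₁] [Algebra A D₂]

/-- `θ` is semilinear over `τ : D₁ → D₂` and fixes the elements `x` of `s`. -/
structure IsTransport (τ : D₁ →+* D₂) {B : Type u} [CommRing B] [Algebra A B] (s : Finset B)
    (θ : D₁ ⊗[A] B →+* D₂ ⊗[A] B) : Prop where
  left : ∀ d, θ (d ⊗ₜ 1) = τ d ⊗ₜ 1
  right : ∀ x ∈ s, θ (1 ⊗ₜ x) = 1 ⊗ₜ x

/-- The transport homomorphisms commute with the base changes of a homomorphism defined over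
`A`. -/
theorem IsTransport.map_comm {τ : D₁ →+* D₂} {B C : Type u} [CommRing B] [CommRing C]
    [Algebra A B] [Algebra A C] {s : Finset B} {r : Finset C}
    (hs : Algebra.adjoin A (s : Set B) = ⊤)
    {θB : D₁ ⊗[A] B →+* D₂ ⊗[A] B} {θC : D₁ ⊗[A] C →+* D₂ ⊗[A] C}
    (hB : IsTransport τ s θB) (hC : IsTransport τ r θC) (f : B →ₐ[A] C)
    (hf : ∀ x ∈ s, f x ∈ r) (z : D₁ ⊗[A] B) :
    θC (map (.id A D₁) f z) = map (.id A D₂) f (θB z) := by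
  have h := extend_transport (φ := includeRight.comp f) (φ' := includeRight.comp f)
    hs hB.left hB.right hC.left (fun x hx => (hC.right _ (hf x hx)).symm) z
  have hD (D : Type u) [CommRing D] [Algebra A D] (z : D ⊗[A] B) :
      extend (includeRight.comp f) z = map (.id A D) f z := by
    refine RingHom.congr_fun (f := (extend (includeRight.comp f)).toRingHom)
      (g := (map (.id A D) f).toRingHom) (tensor_ringHom_ext (fun d => ?_) fun b => ?_) z
    · change extend _ _ = map _ _ _
      simp
    · change extend _ _ = map _ _ _
      simp
  rw [hD, hD] at h
  exact h.symm

variable {X X' : ActionAlgebra A κ}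

/-- A homomorphism of diagrams over `D₁` can be transported to `D₂` when `τ` respects the
coefficients `t` of the relations. -/
theorem BaseChangeHom.exists_transport (G : X.Generators) (G' : X'.Generators)
    {t : Finset A} (hB : ContainsCoeffs G.sB t) (hM : ContainsCoeffs G.sM t)
    (τ : D₁ →+* D₂) (hτ : ∀ a ∈ t, τ (algebraMap A D₁ a) = algebraMap A D₂ a)
    {θB : D₁ ⊗[A] X'.B →+* D₂ ⊗[A] X'.B} {θM : D₁ ⊗[A] X'.M →+* D₂ ⊗[A] X'.M}
    (hθB : IsTransport τ G'.sB θB) (hθM : IsTransport τ G'.sM θM) (f : BaseChangeHom X X' D₁) :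
    ∃ f' : BaseChangeHom X X' D₂, (∀ x ∈ G.sB, f'.φ x = θB (f.φ x)) ∧
      ∀ x ∈ G.sM, f'.Φ x = θM (f.Φ x) := by
  obtain ⟨φ, hφ⟩ := hB.exists_algHom τ hτ θB hθB.left f.φ
  obtain ⟨Φ, hΦ⟩ := hM.exists_algHom τ hτ θM hθM.left f.Φ
  have key (u : X.B →ₐ[A] X.M) (v : X'.B →ₐ[A] X'.M) (hu : ∀ x ∈ G.sB, u x ∈ G.sM)
      (hv : ∀ x ∈ G'.sB, v x ∈ G'.sM) (h : ∀ b, f.Φ (u b) = map (.id A D₁) v (f.φ b)) (b : X.B) :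
      Φ (u b) = map (.id A D₂) v (φ b) := by
    refine RingHom.congr_fun (f := (Φ.comp u).toRingHom)
      (g := (((map (.id A D₂) v).restrictScalars A).comp φ).toRingHom)
      (ringHom_ext_of_adjoin_eq_top G.adjoin_sB (fun a => ?_) fun x hx => ?_) b
    · exact ((Φ.comp u).commutes a).trans
        ((((map (.id A D₂) v).restrictScalars A).comp φ).commutes a).symm
    · change Φ (u x) = map (.id A D₂) v (φ x)
      rw [hΦ _ (hu x hx), h, hφ x hx, hθB.map_comm G'.adjoin_sB hθM v hv]
  refine ⟨⟨φ, Φ, key _ _ G.a_mem G'.a_mem f.comp_a, key _ _ G.s_mem G'.s_mem f.comp_s,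
    fun i => ?_⟩, hφ, hΦ⟩
  rw [hΦ _ (G.mark_mem i), f.comp_mark, hθM.right _ (G'.mark_mem i)]

/-- Transport preserves the property of being mutually inverse. -/
theorem extend_eq_one_tmul_of_transport {B C : Type u} [CommRing B] [CommRing C] [Algebra A B]
    [Algebra A C] {s : Finset B} {r : Finset C} (hs : Algebra.adjoin A (s : Set B) = ⊤)
    (hr : Algebra.adjoin A (r : Set C) = ⊤) {τ : D₁ →+* D₂}
    {θB : D₁ ⊗[A] B →+* D₂ ⊗[A] B} {θC : D₁ ⊗[A] C →+* D₂ ⊗[A] C}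
    (hB : IsTransport τ s θB) (hC : IsTransport τ r θC)
    {φ : B →ₐ[A] D₁ ⊗[A] C} {φ' : B →ₐ[A] D₂ ⊗[A] C} (hφ : ∀ x ∈ s, φ' x = θC (φ x))
    {ψ : C →ₐ[A] D₁ ⊗[A] B} {ψ' : C →ₐ[A] D₂ ⊗[A] B} (hψ : ∀ x ∈ r, ψ' x = θB (ψ x))
    (h : ∀ b, extend ψ (φ b) = 1 ⊗ₜ b) (b : B) : extend ψ' (φ' b) = 1 ⊗ₜ b := by
  refine RingHom.congr_fun (f := (((extend ψ').restrictScalars A).comp φ').toRingHom)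
    (g := (includeRight : B →ₐ[A] D₂ ⊗[A] B).toRingHom)
    (ringHom_ext_of_adjoin_eq_top hs (fun a => ?_) fun x hx => ?_) b
  · exact ((((extend ψ').restrictScalars A).comp φ').commutes a).trans
      ((includeRight : B →ₐ[A] D₂ ⊗[A] B).commutes a).symm
  · change extend ψ' (φ' x) = 1 ⊗ₜ x
    rw [hφ x hx, extend_transport hr hC.left hC.right hB.left hψ, h, hB.right x hx]

/-- Becoming isomorphic over `D` depends only on the images in `D` of finitely many elements of
`A`, the coefficients of the relations. -/
theorem exists_finset_becomeIso [Finite κ] (X X' : ActionAlgebra A κ) :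
    ∃ t : Finset A, ∀ {D₁ D₂ : Type u} [CommRing D₁] [CommRing D₂] [Algebra A D₁] [Algebra A D₂]
      (τ : D₁ →+* D₂), (∀ a ∈ t, τ (algebraMap A D₁ a) = algebraMap A D₂ a) →
      BecomeIso X X' D₁ → BecomeIso X X' D₂ := by
  classical
  obtain ⟨G⟩ := X.nonempty_generators
  obtain ⟨G'⟩ := X'.nonempty_generators
  obtain ⟨t₁, h₁⟩ : ∃ t, ContainsCoeffs G.sB t := exists_finset_ringHom_change G.sB G.adjoin_sB
  obtain ⟨t₂, h₂⟩ : ∃ t, ContainsCoeffs G.sM t := exists_finset_ringHom_change G.sM G.adjoin_sM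
  obtain ⟨t₃, h₃⟩ : ∃ t, ContainsCoeffs G'.sB t :=
    exists_finset_ringHom_change G'.sB G'.adjoin_sB
  obtain ⟨t₄, h₄⟩ : ∃ t, ContainsCoeffs G'.sM t :=
    exists_finset_ringHom_change G'.sM G'.adjoin_sM
  let t := (t₁ ∪ t₂) ∪ (t₃ ∪ t₄)
  replace h₁ : ContainsCoeffs G.sB t := h₁.mono fun x hx => by simp [t, hx]
  replace h₂ : ContainsCoeffs G.sM t := h₂.mono fun x hx => by simp [t, hx]
  replace h₃ : ContainsCoeffs G'.sB t := h₃.mono fun x hx => by simp [t, hx]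
  replace h₄ : ContainsCoeffs G'.sM t := h₄.mono fun x hx => by simp [t, hx]
  refine ⟨t, fun {D₁ D₂} _ _ _ _ τ hτ ⟨f, g, hgf, hfg, hGF, hFG⟩ => ?_⟩
  obtain ⟨θ₁, l₁, r₁⟩ := h₁.exists_tensor τ hτ
  obtain ⟨θ₂, l₂, r₂⟩ := h₂.exists_tensor τ hτ
  obtain ⟨θ₃, l₃, r₃⟩ := h₃.exists_tensor τ hτ
  obtain ⟨θ₄, l₄, r₄⟩ := h₄.exists_tensor τ hτ
  have T₁ : IsTransport τ G.sB θ₁ := ⟨l₁, r₁⟩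
  have T₂ : IsTransport τ G.sM θ₂ := ⟨l₂, r₂⟩
  have T₃ : IsTransport τ G'.sB θ₃ := ⟨l₃, r₃⟩
  have T₄ : IsTransport τ G'.sM θ₄ := ⟨l₄, r₄⟩
  obtain ⟨f', hφ, hΦ⟩ := f.exists_transport G G' h₁ h₂ τ hτ T₃ T₄
  obtain ⟨g', hψ, hΨ⟩ := g.exists_transport G' G h₃ h₄ τ hτ T₁ T₂
  exact ⟨f', g',
    extend_eq_one_tmul_of_transport G.adjoin_sB G'.adjoin_sB T₁ T₃ hφ hψ hgf,
    extend_eq_one_tmul_of_transport G'.adjoin_sB G.adjoin_sB T₃ T₁ hψ hφ hfg,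
    extend_eq_one_tmul_of_transport G.adjoin_sM G'.adjoin_sM T₂ T₄ hΦ hΨ hGF,
    extend_eq_one_tmul_of_transport G'.adjoin_sM G.adjoin_sM T₄ T₂ hΨ hΦ hFG⟩

end TransportDiagrams

/-! ### Spreading out from a union of finitely generated subalgebras -/

section Spreading

open scoped TensorProduct
open Algebra.TensorProduct Filter

variable {A : Type u} [CommRing A] {Ω : Type u} [CommRing Ω] [Algebra A Ω]

variable (A Ω) in
/-- The finitely generated `A`-subalgebras of `Ω`. -/
abbrev FGSubalgebra := {R : Subalgebra A Ω // R.FG}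

instance : IsDirectedOrder (FGSubalgebra A Ω) :=
  ⟨fun R S => ⟨⟨R.1 ⊔ S.1, R.2.sup S.2⟩, le_sup_left (a := R.1), le_sup_right (a := R.1)⟩⟩

instance : Nonempty (FGSubalgebra A Ω) := ⟨⟨⊥, Subalgebra.fg_bot⟩⟩

/-- The map `R ⊗ C → S ⊗ C` for subalgebras `R ≤ S`. -/
noncomputable abbrev incl {R S : FGSubalgebra A Ω} (h : R ≤ S) (C : Type u) [CommRing C]
    [Algebra A C] : R.1 ⊗[A] C →ₐ[A] S.1 ⊗[A] C :=
  push C (Subalgebra.inclusion (show R.1 ≤ S.1 from h))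

theorem incl_incl {R S T : FGSubalgebra A Ω} (h : R ≤ S) (h' : S ≤ T) {C : Type u} [CommRing C]
    [Algebra A C] (z : R.1 ⊗[A] C) : incl h' C (incl h C z) = incl (h.trans h') C z := by
  induction z using TensorProduct.induction_on with
  | zero => simp only [map_zero]
  | tmul d c => simp
  | add x y hx hy => simp only [map_add, hx, hy]

theorem push_incl {R S : FGSubalgebra A Ω} (h : R ≤ S) {C : Type u} [CommRing C]
    [Algebra A C] (z : R.1 ⊗[A] C) : push C S.1.val (incl h C z) = push C R.1.val z := by
  induction z using TensorProduct.induction_on with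
  | zero => simp only [map_zero]
  | tmul d c => simp
  | add x y hx hy => simp only [map_add, hx, hy]

variable {B C : Type u} [CommRing B] [CommRing C] [Algebra A B] [Algebra A C]

theorem eventually_exists_push_eq (z : Ω ⊗[A] C) :
    ∀ᶠ R : FGSubalgebra A Ω in atTop, ∃ w, push C R.1.val w = z := by
  obtain ⟨R, hR, w, hw⟩ := TensorProduct.Algebra.exists_of_fg z
  filter_upwards [eventually_ge_atTop (⟨R, hR⟩ : FGSubalgebra A Ω)] with S hS
  exact ⟨incl hS C w, (push_incl hS w).trans hw⟩

theorem eventually_incl_eq {R : FGSubalgebra A Ω} {z w : R.1 ⊗[A] C}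
    (h : push C R.1.val z = push C R.1.val w) :
    ∀ᶠ S in atTop, ∀ hS : R ≤ S, incl hS C z = incl hS C w := by
  obtain ⟨T, hT, hT', h'⟩ := TensorProduct.Algebra.eq_of_fg_of_subtype_eq R.2 h
  let T' : FGSubalgebra A Ω := ⟨T, hT'⟩
  filter_upwards [eventually_ge_atTop T'] with S hS hRS
  have hRT : R ≤ T' := hT
  have := congrArg (incl hS C) (show incl hRT C z = incl hRT C w from h')
  rwa [incl_incl, incl_incl] at this

/-- Two homomorphisms from an algebra of finite type which agree after passing to `Ω` agree over a
finitely generated subalgebra. -/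
theorem eventually_incl_comp_eq [Algebra.FiniteType A B] {R : FGSubalgebra A Ω}
    {f g : B →ₐ[A] R.1 ⊗[A] C} (h : ∀ b, push C R.1.val (f b) = push C R.1.val (g b)) :
    ∀ᶠ S in atTop, ∀ hS : R ≤ S, ∀ b, incl hS C (f b) = incl hS C (g b) := by
  obtain ⟨s, hs⟩ := (inferInstance : Algebra.FiniteType A B).out
  have := (eventually_all_finset s).2 fun b _ => eventually_incl_eq (h b)
  filter_upwards [this] with S hS hRS b
  refine AlgHom.congr_fun (φ₁ := (incl hRS C).comp f) (φ₂ := (incl hRS C).comp g)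
    (AlgHom.ext_of_adjoin_eq_top hs fun x hx => hS x hx hRS) b

/-- A homomorphism from a finitely presented algebra to `Ω ⊗ C` is defined over a finitely
generated subalgebra. -/
theorem eventually_exists_algHom [Algebra.FinitePresentation A B] (φ : B →ₐ[A] Ω ⊗[A] C) :
    ∀ᶠ R : FGSubalgebra A Ω in atTop, ∃ φ' : B →ₐ[A] R.1 ⊗[A] C,
      ∀ b, push C R.1.val (φ' b) = φ b := by
  obtain ⟨n, f, hf, r, hr⟩ := Algebra.FinitePresentation.out (R := A) (A := B)
  obtain ⟨R, hR⟩ := (eventually_all.2 fun i : Fin n =>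
    eventually_exists_push_eq (φ (f (MvPolynomial.X i)))).exists
  choose c hc using hR
  let g : MvPolynomial (Fin n) A →ₐ[A] R.1 ⊗[A] C := MvPolynomial.aeval c
  have hg (p) : push C R.1.val (g p) = φ (f p) :=
    AlgHom.congr_fun (φ₁ := (push C R.1.val).comp g) (φ₂ := φ.comp f)
      (MvPolynomial.algHom_ext fun i => by
        change push C R.1.val (MvPolynomial.aeval c _) = φ (f _)
        rw [MvPolynomial.aeval_X, hc]) p
  have hev := (eventually_all_finset r).2 fun p hp =>
    eventually_incl_eq (R := R) (z := g p) (w := 0) (by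
      rw [hg, map_zero]
      have : f p = 0 := by
        have : p ∈ RingHom.ker f.toRingHom := hr ▸ Ideal.subset_span hp
        exact this
      rw [this, map_zero])
  filter_upwards [hev, eventually_ge_atTop R] with S hS hRS
  have hker (p : MvPolynomial (Fin n) A) (hp : f p = 0) : incl hRS C (g p) = 0 := by
    have hp' : p ∈ Ideal.span (r : Set _) := hr ▸ hp
    change p ∈ RingHom.ker ((incl hRS C).comp g).toRingHom
    refine (Ideal.span_le (I := RingHom.ker ((incl hRS C).comp g).toRingHom)).2
      (fun q hq => ?_) hp'
    exact (hS q hq hRS).trans (map_zero _)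
  let φ' : B →ₐ[A] S.1 ⊗[A] C :=
    (Ideal.Quotient.liftₐ (RingHom.ker f) ((incl hRS C).comp g) hker).comp
      (Ideal.quotientKerAlgEquivOfSurjective hf).symm.toAlgHom
  refine ⟨φ', fun b => ?_⟩
  obtain ⟨p, rfl⟩ := hf b
  have h1 : (Ideal.quotientKerAlgEquivOfSurjective hf).symm (f p) =
      Ideal.Quotient.mk (RingHom.ker f) p := by
    rw [AlgEquiv.symm_apply_eq]
    rfl
  have h2 : φ' (f p) = incl hRS C (g p) := by
    change Ideal.Quotient.liftₐ (RingHom.ker f) ((incl hRS C).comp g) hker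
      ((Ideal.quotientKerAlgEquivOfSurjective hf).symm (f p)) = _
    rw [h1]
    rfl
  rw [h2, push_incl, hg]

theorem map_push {D D' : Type u} [CommRing D] [CommRing D'] [Algebra A D] [Algebra A D']
    (j : D →ₐ[A] D') (u : B →ₐ[A] C) (z : D ⊗[A] B) :
    map (.id A D') u (push B j z) = push C j (map (.id A D) u z) := by
  induction z using TensorProduct.induction_on with
  | zero => simp only [map_zero]
  | tmul d c => simp
  | add x y hx hy => simp only [map_add, hx, hy]

theorem push_one_tmul {D D' : Type u} [CommRing D] [CommRing D'] [Algebra A D] [Algebra A D']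
    (j : D →ₐ[A] D') (c : C) : push C j (1 ⊗ₜ c) = 1 ⊗ₜ c := by
  simp

/-- If `φ` and `ψ` become mutually inverse over `Ω`, they do so over a finitely generated
subalgebra. -/
theorem eventually_extend_eq [Algebra.FiniteType A B] {R : FGSubalgebra A Ω}
    {φ : B →ₐ[A] R.1 ⊗[A] C} {ψ : C →ₐ[A] R.1 ⊗[A] B}
    {φΩ : B →ₐ[A] Ω ⊗[A] C} {ψΩ : C →ₐ[A] Ω ⊗[A] B}
    (hφ : ∀ b, push C R.1.val (φ b) = φΩ b) (hψ : ∀ b, push B R.1.val (ψ b) = ψΩ b)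
    (h : ∀ b, extend ψΩ (φΩ b) = 1 ⊗ₜ b) :
    ∀ᶠ S in atTop, ∀ hS : R ≤ S, ∀ b,
      extend ((incl hS B).comp ψ) (incl hS C (φ b)) = 1 ⊗ₜ b := by
  have := eventually_incl_comp_eq (R := R) (f := ((extend ψ).restrictScalars A).comp φ)
    (g := includeRight) fun b => by
      change push B R.1.val (extend ψ (φ b)) = push B R.1.val (1 ⊗ₜ b)
      have hψ' : ψΩ = (push B R.1.val).comp ψ := AlgHom.ext fun c => (hψ c).symm
      rw [← extend_push, hφ, ← hψ', h, push_one_tmul]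
  filter_upwards [this] with S hS hRS b
  rw [extend_push]
  exact (hS hRS b).trans (push_one_tmul _ b)

/-- If `φ` and `Φ` become compatible with the structure maps `u` and `v` over `Ω`, they do so over a
finitely generated subalgebra. -/
theorem eventually_comp_eq {M N : Type u} [CommRing M] [CommRing N] [Algebra A M] [Algebra A N]
    [Algebra.FiniteType A B] {R : FGSubalgebra A Ω}
    {φ : B →ₐ[A] R.1 ⊗[A] C} {Φ : M →ₐ[A] R.1 ⊗[A] N} (u : B →ₐ[A] M) (v : C →ₐ[A] N)
    {φΩ : B →ₐ[A] Ω ⊗[A] C} {ΦΩ : M →ₐ[A] Ω ⊗[A] N}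
    (hφ : ∀ b, push C R.1.val (φ b) = φΩ b) (hΦ : ∀ b, push N R.1.val (Φ b) = ΦΩ b)
    (h : ∀ b, ΦΩ (u b) = map (.id A Ω) v (φΩ b)) :
    ∀ᶠ S in atTop, ∀ hS : R ≤ S, ∀ b,
      incl hS N (Φ (u b)) = map (.id A S.1) v (incl hS C (φ b)) := by
  have := eventually_incl_comp_eq (R := R) (f := Φ.comp u)
    (g := ((map (.id A R.1) v).restrictScalars A).comp φ) fun b => by
      change push N R.1.val (Φ (u b)) = push N R.1.val (map (.id A R.1) v (φ b))
      rw [← map_push, hφ, hΦ, h]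
  filter_upwards [this] with S hS hRS b
  rw [map_push]
  exact hS hRS b

variable {κ : Type*} {X X' : ActionAlgebra A κ}

/-- A homomorphism of diagrams over `Ω` is defined over a finitely generated subalgebra. -/
theorem eventually_baseChangeHom [Finite κ] (f : BaseChangeHom X X' Ω) :
    ∀ᶠ R : FGSubalgebra A Ω in atTop, ∃ f' : BaseChangeHom X X' R.1,
      (∀ b, push X'.B R.1.val (f'.φ b) = f.φ b) ∧ ∀ b, push X'.M R.1.val (f'.Φ b) = f.Φ b := by
  obtain ⟨R, ⟨φ, hφ⟩, Φ, hΦ⟩ :=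
    ((eventually_exists_algHom f.φ).and (eventually_exists_algHom f.Φ)).exists
  have hmark := eventually_all.2 fun i => eventually_incl_eq (R := R) (z := Φ (X.mark i))
    (w := 1 ⊗ₜ X'.mark i) (by rw [hΦ, f.comp_mark, push_one_tmul])
  filter_upwards [eventually_ge_atTop R, eventually_comp_eq X.a X'.a hφ hΦ f.comp_a,
    eventually_comp_eq X.s X'.s hφ hΦ f.comp_s, hmark] with S hRS ha hs hm
  refine ⟨⟨(incl hRS _).comp φ, (incl hRS _).comp Φ, ha hRS, hs hRS, fun i => ?_⟩,
    fun b => ?_, fun b => ?_⟩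
  · exact (hm i hRS).trans (push_one_tmul _ _)
  · exact (push_incl hRS _).trans (hφ b)
  · exact (push_incl hRS _).trans (hΦ b)

/-- An isomorphism over `Ω` is defined over a finitely generated subalgebra. -/
theorem BecomeIso.exists_fg [Finite κ] (h : BecomeIso X X' Ω) :
    ∃ R : FGSubalgebra A Ω, BecomeIso X X' R.1 := by
  obtain ⟨f, g, hgf, hfg, hGF, hFG⟩ := h
  obtain ⟨R, ⟨f', hφ, hΦ⟩, g', hψ, hΨ⟩ :=
    ((eventually_baseChangeHom f).and (eventually_baseChangeHom g)).exists
  obtain ⟨S, hRS, h₁, h₂, h₃, h₄⟩ := ((eventually_ge_atTop R).and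
    ((eventually_extend_eq hφ hψ hgf).and ((eventually_extend_eq hψ hφ hfg).and
      ((eventually_extend_eq hΦ hΨ hGF).and (eventually_extend_eq hΨ hΦ hFG))))).exists
  have mk {X X' : ActionAlgebra A κ} (f : BaseChangeHom X X' R.1) :
      ∃ f' : BaseChangeHom X X' S.1, f'.φ = (incl hRS _).comp f.φ ∧
        f'.Φ = (incl hRS _).comp f.Φ :=
    ⟨⟨(incl hRS _).comp f.φ, (incl hRS _).comp f.Φ,
      fun b => (congrArg (incl hRS _) (f.comp_a b)).trans (map_push _ _ _).symm,
      fun b => (congrArg (incl hRS _) (f.comp_s b)).trans (map_push _ _ _).symm,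
      fun i => (congrArg (incl hRS _) (f.comp_mark i)).trans (push_one_tmul _ _)⟩, rfl, rfl⟩
  obtain ⟨f₂, e₁, e₂⟩ := mk f'
  obtain ⟨g₂, e₃, e₄⟩ := mk g'
  refine ⟨S, f₂, g₂, ?_⟩
  rw [e₁, e₂, e₃, e₄]
  exact ⟨h₁ hRS, h₂ hRS, h₃ hRS, h₄ hRS⟩

end Spreading

/-! ### Generically étale and quasi-finite algebras, and the affine theorem -/

section Affine

open scoped TensorProduct

/-- A finitely generated domain algebraic over `A` is quasi-finite over `A` after a denominator
from `A` is inverted. -/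
theorem exists_quasiFinite_ge {A Ω : Type u} [CommRing A] [IsDomain A] [Field Ω] [Algebra A Ω]
    [FaithfulSMul A Ω] [Algebra.IsAlgebraic A Ω] (R : FGSubalgebra A Ω) :
    ∃ S : FGSubalgebra A Ω, R ≤ S ∧ Algebra.QuasiFinite A S.1 := by
  classical
  obtain ⟨R, hR⟩ := R
  obtain ⟨g, hg⟩ := hR
  obtain ⟨r, hr, hint⟩ := Algebra.IsAlgebraic.exists_integral_multiples A g
  set ρ : Ω := algebraMap A Ω r with hρ
  have hρ0 : ρ ≠ 0 := by
    rw [hρ, Ne, FaithfulSMul.algebraMap_eq_zero_iff]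
    exact hr
  -- `S` is generated by `R` and the inverse of a common denominator `ρ`; it is a localization of
  -- the finite `A`-algebra `T`.
  let S : FGSubalgebra A Ω :=
    ⟨Algebra.adjoin A ((insert ρ⁻¹ g : Finset Ω) : Set Ω), Subalgebra.fg_adjoin_finset _⟩
  have hRS : R ≤ S.1 := hg ▸ Algebra.adjoin_mono (by simp)
  let T : Subalgebra A Ω := Algebra.adjoin A ((g.image fun x => r • x : Finset Ω) : Set Ω)
  have hTS : T ≤ S.1 := by
    refine Algebra.adjoin_le fun x hx => ?_
    obtain ⟨y, hy, rfl⟩ := Finset.mem_image.1 (Finset.mem_coe.1 hx)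
    exact S.1.smul_mem (Algebra.subset_adjoin (by simp [hy])) r
  have hT : Module.Finite A T := by
    refine Algebra.finite_adjoin_of_finite_of_isIntegral (Finset.finite_toSet _) fun x hx => ?_
    obtain ⟨y, hy, rfl⟩ := Finset.mem_image.1 (Finset.mem_coe.1 hx)
    exact hint y hy
  have key (t : Ω) (ht : t ∈ S.1) : ∃ n : ℕ, t * ρ ^ n ∈ T := by
    have hρT : ∀ n : ℕ, ρ ^ n ∈ T := fun n => T.pow_mem (T.algebraMap_mem r) n
    induction ht using Algebra.adjoin_induction with
    | mem x hx =>
      refine ⟨1, ?_⟩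
      rw [Finset.coe_insert, Set.mem_insert_iff] at hx
      rcases hx with rfl | hx
      · rw [pow_one, inv_mul_cancel₀ hρ0]
        exact T.one_mem
      · refine Algebra.subset_adjoin (Finset.mem_coe.2 (Finset.mem_image.2 ⟨x, hx, ?_⟩))
        rw [pow_one, mul_comm, Algebra.smul_def]
    | algebraMap a => exact ⟨0, by rw [pow_zero, _root_.mul_one]; exact T.algebraMap_mem a⟩
    | add x y _ _ hx hy =>
      obtain ⟨n, hn⟩ := hx
      obtain ⟨m, hm⟩ := hy
      refine ⟨n + m, ?_⟩
      have : (x + y) * ρ ^ (n + m) = x * ρ ^ n * ρ ^ m + y * ρ ^ m * ρ ^ n := by ring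
      rw [this]
      exact T.add_mem (T.mul_mem hn (hρT m)) (T.mul_mem hm (hρT n))
    | mul x y _ _ hx hy =>
      obtain ⟨n, hn⟩ := hx
      obtain ⟨m, hm⟩ := hy
      refine ⟨n + m, ?_⟩
      have : x * y * ρ ^ (n + m) = x * ρ ^ n * (y * ρ ^ m) := by ring
      rw [this]
      exact T.mul_mem hn hm
  refine ⟨S, ?_, ?_⟩
  · exact hRS
  · refine Algebra.QuasiFinite.of_forall_exists_mul_mem_range (Subalgebra.inclusion hTS)
      fun t => ?_
    obtain ⟨n, hn⟩ := key t t.2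
    refine ⟨⟨ρ ^ n, T.pow_mem (T.algebraMap_mem r) n⟩, ?_, ?_⟩
    · have hmem : ρ⁻¹ ∈ S.1 := Algebra.subset_adjoin (by simp)
      have hu : IsUnit (⟨ρ, S.1.algebraMap_mem r⟩ : S.1) :=
        .of_mul_eq_one ⟨ρ⁻¹, hmem⟩ (Subtype.ext (mul_inv_cancel₀ hρ0))
      exact hu.pow n
    · exact ⟨⟨_, hn⟩, Subtype.ext rfl⟩

/-- In characteristic zero, a finitely generated domain algebraic over `A` is generically étale
over `A`. -/
theorem exists_etale_localization {A D : Type u} [CommRing A] [IsDomain A] [IsNoetherianRing A]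
    [CommRing D] [IsDomain D] [Algebra A D] [FaithfulSMul A D] [Algebra.FiniteType A D]
    [Algebra.IsAlgebraic A D] [CharZero A] :
    ∃ s : D, s ≠ 0 ∧ Algebra.Etale A (Localization.Away s) := by
  have : Algebra.FinitePresentation A D := Algebra.FinitePresentation.of_finiteType.1 inferInstance
  -- At the generic point `D` is an algebraic field extension in characteristic zero, hence
  -- separable.
  have hE : Algebra.IsEtaleAt A (⊥ : Ideal D) := by
    let _ := FractionRing.liftAlgebra A (FractionRing D)
    have := FractionRing.isScalarTower_liftAlgebra A (FractionRing D)
    have : Algebra.IsAlgebraic (FractionRing A) (FractionRing D) :=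
      have := (IsFractionRing.isAlgebraic_iff' A D (FractionRing D)).1 inferInstance
      ⟨fun x => (IsFractionRing.isAlgebraic_iff A (FractionRing A) (FractionRing D)).1
        (Algebra.IsAlgebraic.isAlgebraic x)⟩
    have : CharZero (FractionRing A) :=
      charZero_of_injective_algebraMap (IsFractionRing.injective A (FractionRing A))
    have h1 : Algebra.FormallyEtale (FractionRing A) (FractionRing D) :=
      Algebra.FormallyEtale.of_isSeparable _ _
    have h2 : Algebra.FormallyEtale A (FractionRing A) :=
      Algebra.FormallyEtale.of_isLocalization (nonZeroDivisors A)
    have h3 : Algebra.FormallyEtale A (FractionRing D) := .comp A (FractionRing A) _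
    have h4 : (⊥ : Ideal D).primeCompl = nonZeroDivisors D := by
      ext x
      simp [Ideal.primeCompl]
    have : IsLocalization (nonZeroDivisors D) (Localization.AtPrime (⊥ : Ideal D)) :=
      h4 ▸ (inferInstance : IsLocalization.AtPrime _ (⊥ : Ideal D))
    exact .of_equiv ((IsLocalization.algEquiv (nonZeroDivisors D) (FractionRing D)
      (Localization.AtPrime (⊥ : Ideal D))).restrictScalars A)
  obtain ⟨s, hs, h⟩ := Algebra.exists_etale_of_isEtaleAt (R := A) (⊥ : Ideal D)
  exact ⟨s, hs, h⟩

/-- The affine case: diagrams of algebras over a finitely generated domain `A` which are isomorphic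
at all `k`-points of `A` become isomorphic over a generically finite extension of `A`. -/
theorem exists_becomeIso {F k : Type u} [Field F] [Field k] [Algebra F k] [IsAlgClosed k]
    (hk : Cardinal.aleph0 ≤ Algebra.trdeg F k)
    {A : Type u} [CommRing A] [IsDomain A] [Algebra k A] [Algebra.FiniteType k A]
    {κ : Type*} [Finite κ] (X X' : ActionAlgebra A κ)
    (h : ∀ y : A →ₐ[k] k, letI := y.toRingHom.toAlgebra; BecomeIso X X' k) :
    ∃ (D : Type u) (_ : CommRing D) (_ : IsDomain D) (_ : Algebra A D),
      Algebra.FiniteType A D ∧ Function.Injective (algebraMap A D) ∧ Algebra.QuasiFinite A D ∧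
      (CharZero k → Algebra.Etale A D) ∧ BecomeIso X X' D := by
  let Ω := AlgebraicClosure (FractionRing A)
  have : FaithfulSMul A Ω := (faithfulSMul_iff_algebraMap_injective _ _).2 <| by
    rw [IsScalarTower.algebraMap_eq A (FractionRing A) Ω]
    exact (algebraMap (FractionRing A) Ω).injective.comp (IsFractionRing.injective _ _)
  have : Algebra.IsAlgebraic A Ω :=
    ⟨fun x => (IsFractionRing.isAlgebraic_iff A (FractionRing A) Ω).2
      (Algebra.IsAlgebraic.isAlgebraic x)⟩
  have : IsNoetherianRing A := Algebra.FiniteType.isNoetherianRing k A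
  obtain ⟨t, ht⟩ := exists_finset_becomeIso X X'
  obtain ⟨y, τ, hτ⟩ := exists_generic_point hk (Ω := Ω) t
  -- The isomorphism over the `k`-point `y` is transported to the geometric generic point.
  have hΩ : BecomeIso X X' Ω := by
    let _ := y.toRingHom.toAlgebra
    exact ht τ hτ (h y)
  obtain ⟨R, hR⟩ := hΩ.exists_fg
  obtain ⟨S, hRS, hqf⟩ := exists_quasiFinite_ge R
  have hft : Algebra.FiniteType A S.1 := (Subalgebra.fg_iff_finiteType _).1 S.2
  obtain ⟨s, hs, het⟩ : ∃ s : S.1, s ≠ 0 ∧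
      (CharZero k → Algebra.Etale A (Localization.Away s)) := by
    by_cases hc : CharZero k
    · have : CharZero A := charZero_of_injective_algebraMap (algebraMap k A).injective
      have : Algebra.IsAlgebraic A S.1 :=
        .of_injective S.1.val Subtype.val_injective
      obtain ⟨s, hs, h⟩ := exists_etale_localization (A := A) (D := S.1)
      exact ⟨s, hs, fun _ => h⟩
    · exact ⟨1, one_ne_zero, fun h => absurd h hc⟩
  have hle : Submonoid.powers s ≤ nonZeroDivisors S.1 :=
    powers_le_nonZeroDivisors_of_noZeroDivisors hs
  have hdom : IsDomain (Localization.Away s) := IsLocalization.isDomain_localization hle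
  refine ⟨Localization.Away s, inferInstance, hdom, inferInstance, ?_, ?_, ?_, het, ?_⟩
  · have : Algebra.FiniteType S.1 (Localization.Away s) := .of_finitePresentation
    exact .trans (S := S.1) inferInstance inferInstance
  · rw [IsScalarTower.algebraMap_eq A S.1 (Localization.Away s)]
    exact (IsLocalization.injective _ hle).comp (FaithfulSMul.algebraMap_injective A S.1)
  · exact .of_isLocalization (Submonoid.powers s)
  · refine ht ((algebraMap S.1 (Localization.Away s)).comp
      (Subalgebra.inclusion hRS).toRingHom) (fun a _ => ?_) hR
    exact (IsScalarTower.algebraMap_apply A S.1 (Localization.Away s) a).symm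

end Affine

/-! ### Diagrams of actions over a base and their base changes -/

section Diagrams

universe v' u'

variable {E : Type u'} [Category.{v'} E]

/-- Two morphisms `a, s : M ⟶ X` over `Y`, together with a morphism `M ⟶ N`. For an action of `N`
on `X` over `Y` these are the action map, the projection to `X` and the projection to `N` of
`M = N × X`. -/
structure ActionDiagram (Y N : E) where
  (X M : E)
  p : X ⟶ Y
  (a s : M ⟶ X)
  w : a ≫ p = s ≫ p
  g : M ⟶ N

variable {Y N U : E}

/-- Base changes of both objects of a diagram along `f : U ⟶ Y`. -/
structure BaseChange (𝒳 : ActionDiagram Y N) (f : U ⟶ Y) where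
  (P PM : E)
  fst : P ⟶ 𝒳.X
  snd : P ⟶ U
  sq : IsPullback fst snd 𝒳.p f
  fstM : PM ⟶ 𝒳.M
  sndM : PM ⟶ U
  sqM : IsPullback fstM sndM (𝒳.s ≫ 𝒳.p) f

namespace BaseChange

variable {𝒳 𝒳' 𝒳'' : ActionDiagram Y N} {f : U ⟶ Y}

/-- The base change of the morphism `a`. -/
noncomputable def act (β : BaseChange 𝒳 f) : β.PM ⟶ β.P :=
  β.sq.lift (β.fstM ≫ 𝒳.a) β.sndM (by rw [Category.assoc, 𝒳.w, β.sqM.w])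

/-- The base change of the morphism `s`. -/
noncomputable def proj (β : BaseChange 𝒳 f) : β.PM ⟶ β.P :=
  β.sq.lift (β.fstM ≫ 𝒳.s) β.sndM (by rw [Category.assoc, β.sqM.w])

variable (β : BaseChange 𝒳 f)

@[simp] theorem act_fst : β.act ≫ β.fst = β.fstM ≫ 𝒳.a := β.sq.lift_fst ..
@[simp] theorem act_snd : β.act ≫ β.snd = β.sndM := β.sq.lift_snd ..
@[simp] theorem proj_fst : β.proj ≫ β.fst = β.fstM ≫ 𝒳.s := β.sq.lift_fst ..
@[simp] theorem proj_snd : β.proj ≫ β.snd = β.sndM := β.sq.lift_snd ..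

/-- An isomorphism over `U` of base changes of two diagrams, compatible with their structure. -/
structure Iso (β : BaseChange 𝒳 f) (β' : BaseChange 𝒳' f) where
  e : β.P ≅ β'.P
  eM : β.PM ≅ β'.PM
  e_snd : e.hom ≫ β'.snd = β.snd
  eM_snd : eM.hom ≫ β'.sndM = β.sndM
  e_act : eM.hom ≫ β'.act = β.act ≫ e.hom
  e_proj : eM.hom ≫ β'.proj = β.proj ≫ e.hom
  e_mark : eM.hom ≫ β'.fstM ≫ 𝒳'.g = β.fstM ≫ 𝒳.g

/-- Composition of isomorphisms. -/
def Iso.trans {β : BaseChange 𝒳 f} {β' : BaseChange 𝒳' f} {β'' : BaseChange 𝒳'' f}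
    (i : Iso β β') (j : Iso β' β'') : Iso β β'' where
  e := i.e ≪≫ j.e
  eM := i.eM ≪≫ j.eM
  e_snd := by simp [j.e_snd, i.e_snd]
  eM_snd := by simp [j.eM_snd, i.eM_snd]
  e_act := by simp [j.e_act, reassoc_of% i.e_act]
  e_proj := by simp [j.e_proj, reassoc_of% i.e_proj]
  e_mark := by simp [j.e_mark, i.e_mark]

/-- The inverse isomorphism. -/
def Iso.symm {β : BaseChange 𝒳 f} {β' : BaseChange 𝒳' f} (i : Iso β β') : Iso β' β where
  e := i.e.symm
  eM := i.eM.symm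
  e_snd := by simp [Iso.inv_comp_eq, i.e_snd]
  eM_snd := by simp [Iso.inv_comp_eq, i.eM_snd]
  e_act := by simp [Iso.inv_comp_eq, reassoc_of% i.e_act]
  e_proj := by simp [Iso.inv_comp_eq, reassoc_of% i.e_proj]
  e_mark := by simp [Iso.inv_comp_eq, i.e_mark]

/-- Uniqueness of base changes. -/
noncomputable def uniq (β β' : BaseChange 𝒳 f) : Iso β β' where
  e := β.sq.isoIsPullback _ _ β'.sq
  eM := β.sqM.isoIsPullback _ _ β'.sqM
  e_snd := by simp
  eM_snd := by simp
  e_act := β'.sq.hom_ext (by simp) (by simp)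
  e_proj := β'.sq.hom_ext (by simp) (by simp)
  e_mark := by simp

/-- Whether two diagrams become isomorphic along `f` does not depend on the choice of their base
changes. -/
theorem Iso.transfer {β : BaseChange 𝒳 f} {β' : BaseChange 𝒳' f}
    (i : Iso β β') (δ : BaseChange 𝒳 f) (δ' : BaseChange 𝒳' f) : Nonempty (Iso δ δ') :=
  ⟨((δ.uniq β).trans i).trans (β'.uniq δ')⟩

end BaseChange

section Coproducts

variable [HasPullbacks E] [FinitaryPreExtensive E] {n : ℕ}

/-- Pullback squares over the members of a finite family give one over its coproduct, because
coproducts are preserved by pullback. -/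
theorem isPullback_sigma {X : E} (p : X ⟶ Y) {U P : Fin n → E} {f : ∀ i, U i ⟶ Y}
    {l : ∀ i, P i ⟶ X} {r : ∀ i, P i ⟶ U i} (h : ∀ i, IsPullback (l i) (r i) p (f i)) :
    IsPullback (Limits.Sigma.desc l) (Limits.Sigma.map r) p (Limits.Sigma.desc f) := by
  have hi : IsIso (Limits.Sigma.desc (Limits.Sigma.ι U)) := by
    have : Limits.Sigma.desc (Limits.Sigma.ι U) = 𝟙 (∐ U) := by ext; simp
    rw [this]
    infer_instance
  obtain ⟨φ, hφ⟩ : ∃ φ, φ = Limits.Sigma.desc f := ⟨_, rfl⟩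
  have hιφ (i) : Sigma.ι U i ≫ φ = f i := by simp [hφ]
  rw [← hφ]
  have hiso := FinitaryPreExtensive.isIso_sigmaDesc_fst (Sigma.ι U) (pullback.snd p φ) hi
  have hex (i) : ∃ c : P i ⟶ pullback p φ, c ≫ pullback.fst p φ = l i ∧
      c ≫ pullback.snd p φ = r i ≫ Sigma.ι U i :=
    ⟨pullback.lift (l i) (r i ≫ Sigma.ι U i) (by rw [Category.assoc, hιφ, (h i).w]),
      pullback.lift_fst .., pullback.lift_snd ..⟩
  choose c hcl hcr using hex
  have hc (i) : IsPullback (c i) (r i) (pullback.snd p φ) (Sigma.ι U i) := by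
    refine IsPullback.of_right (h₁₂ := pullback.fst p φ) (h₂₂ := φ) (v₁₃ := p) ?_ (hcr i)
      (IsPullback.of_hasPullback p φ)
    rw [hcl, hιφ]
    exact h i
  have hcomp : Limits.Sigma.desc c = (Limits.Sigma.mapIso fun i => (hc i).isoPullback).hom ≫
      Limits.Sigma.desc fun i => pullback.fst (pullback.snd p φ) (Sigma.ι U i) :=
    Limits.Sigma.hom_ext _ _ fun i => by simp
  have : IsIso (Limits.Sigma.desc c) := by rw [hcomp]; infer_instance
  refine IsPullback.of_iso (IsPullback.of_hasPullback p φ) (asIso (Limits.Sigma.desc c)).symm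
    (.refl _) (.refl _) (.refl _) ?_ ?_ (by simp) (by simp)
  · rw [Iso.symm_hom, asIso_inv, Iso.refl_hom, Category.comp_id, IsIso.eq_inv_comp]
    exact Limits.Sigma.hom_ext _ _ fun i => by simp [hcl]
  · rw [Iso.symm_hom, asIso_inv, Iso.refl_hom, Category.comp_id, IsIso.eq_inv_comp]
    exact Limits.Sigma.hom_ext _ _ fun i => by simp [hcr]

variable {𝒳 𝒳' : ActionDiagram Y N} {U : Fin n → E} {f : ∀ i, U i ⟶ Y}

/-- The base change along a finite coproduct. -/
noncomputable def BaseChange.sigma (β : ∀ i, BaseChange 𝒳 (f i)) :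
    BaseChange 𝒳 (Limits.Sigma.desc f) where
  P := ∐ fun i => (β i).P
  PM := ∐ fun i => (β i).PM
  fst := Limits.Sigma.desc fun i => (β i).fst
  snd := Limits.Sigma.map fun i => (β i).snd
  sq := isPullback_sigma _ fun i => (β i).sq
  fstM := Limits.Sigma.desc fun i => (β i).fstM
  sndM := Limits.Sigma.map fun i => (β i).sndM
  sqM := isPullback_sigma _ fun i => (β i).sqM

/-- Isomorphisms of base changes along the members of a finite family glue. -/
noncomputable def BaseChange.Iso.sigma {β : ∀ i, BaseChange 𝒳 (f i)}
    {β' : ∀ i, BaseChange 𝒳' (f i)} (e : ∀ i, Iso (β i) (β' i)) :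
    Iso (BaseChange.sigma β) (BaseChange.sigma β') where
  e := Limits.Sigma.mapIso fun i => (e i).e
  eM := Limits.Sigma.mapIso fun i => (e i).eM
  e_snd := Limits.Sigma.hom_ext _ _ fun i => by simp [BaseChange.sigma, reassoc_of% (e i).e_snd]
  eM_snd := Limits.Sigma.hom_ext _ _ fun i => by simp [BaseChange.sigma, reassoc_of% (e i).eM_snd]
  e_act := by
    have h {𝒳 : ActionDiagram Y N} (β : ∀ i, BaseChange 𝒳 (f i)) :
        (BaseChange.sigma β).act = Limits.Sigma.map fun i => (β i).act :=
      (BaseChange.sigma β).sq.hom_ext (by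
        rw [act_fst]; exact Limits.Sigma.hom_ext _ _ fun i => by simp [BaseChange.sigma]) (by
        rw [act_snd]
        exact Limits.Sigma.hom_ext _ _ fun i => by
          simp [BaseChange.sigma, reassoc_of% (β i).act_snd])
    rw [h, h]
    have key : (Limits.Sigma.mapIso fun i => (e i).eM).hom ≫
        Limits.Sigma.map (fun i => (β' i).act) =
        Limits.Sigma.map (fun i => (β i).act) ≫ (Limits.Sigma.mapIso fun i => (e i).e).hom :=
      Limits.Sigma.hom_ext _ _ fun i => by simp [reassoc_of% (e i).e_act]
    exact key
  e_proj := by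
    have h {𝒳 : ActionDiagram Y N} (β : ∀ i, BaseChange 𝒳 (f i)) :
        (BaseChange.sigma β).proj = Limits.Sigma.map fun i => (β i).proj :=
      (BaseChange.sigma β).sq.hom_ext (by
        rw [proj_fst]; exact Limits.Sigma.hom_ext _ _ fun i => by simp [BaseChange.sigma]) (by
        rw [proj_snd]
        exact Limits.Sigma.hom_ext _ _ fun i => by
          simp [BaseChange.sigma, reassoc_of% (β i).proj_snd])
    rw [h, h]
    have key : (Limits.Sigma.mapIso fun i => (e i).eM).hom ≫
        Limits.Sigma.map (fun i => (β' i).proj) =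
        Limits.Sigma.map (fun i => (β i).proj) ≫ (Limits.Sigma.mapIso fun i => (e i).e).hom :=
      Limits.Sigma.hom_ext _ _ fun i => by simp [reassoc_of% (e i).e_proj]
    exact key
  e_mark := Limits.Sigma.hom_ext _ _ fun i => by simp [BaseChange.sigma, (e i).e_mark]

end Coproducts

end Diagrams

/-! ### Affine charts -/

section Charts

open scoped TensorProduct

variable {k A R : Type u} [CommRing k] [CommRing A] [CommRing R] [Algebra k A] [Algebra k R]
  {κ : Type*} {Y : Scheme.{u}}

/-- The base change of a diagram of schemes along `j : Spec A ⟶ Y` is given by a diagram of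
`A`-algebras, whose marked elements are the images of the family `r` of functions on
`N = Spec R`. -/
structure Chart (k : Type u) [CommRing k] [Algebra k A] [Algebra k R]
    (𝒳 : ActionDiagram Y (Spec (.of R))) (j : Spec (.of A) ⟶ Y) (r : κ → R)
    (X : ActionAlgebra A κ) where
  l : Spec (.of X.B) ⟶ 𝒳.X
  sq : IsPullback l (Spec.map (CommRingCat.ofHom (algebraMap A X.B))) 𝒳.p j
  lM : Spec (.of X.M) ⟶ 𝒳.M
  sqM : IsPullback lM (Spec.map (CommRingCat.ofHom (algebraMap A X.M))) (𝒳.s ≫ 𝒳.p) j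
  comm_a : Spec.map (CommRingCat.ofHom X.a.toRingHom) ≫ l = lM ≫ 𝒳.a
  comm_s : Spec.map (CommRingCat.ofHom X.s.toRingHom) ≫ l = lM ≫ 𝒳.s
  ρ : R →+* X.M
  comm_g : Spec.map (CommRingCat.ofHom ρ) = lM ≫ 𝒳.g
  ρ_algebraMap : ∀ x : k, ρ (algebraMap k R x) = algebraMap A X.M (algebraMap k A x)
  ρ_mark : ∀ i, ρ (r i) = X.mark i

variable (D : Type u) [CommRing D] [Algebra A D]

theorem isPullback_Spec_tensor (B : Type u) [CommRing B] [Algebra A B] :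
    IsPullback (Spec.map (CommRingCat.ofHom
        (Algebra.TensorProduct.includeRight : B →ₐ[A] D ⊗[A] B).toRingHom))
      (Spec.map (CommRingCat.ofHom (algebraMap D (D ⊗[A] B))))
      (Spec.map (CommRingCat.ofHom (algebraMap A B)))
      (Spec.map (CommRingCat.ofHom (algebraMap A D))) :=
  (isPullback_SpecMap_of_isPushout _ _ _ _
    (CommRingCat.isPushout_tensorProduct A D B)).flip

variable {𝒳 𝒳' : ActionDiagram Y (Spec (.of R))} {j : Spec (.of A) ⟶ Y} {r : κ → R}
  {X X' : ActionAlgebra A κ}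

/-- The base change along `Spec D ⟶ Spec A ⟶ Y` given by tensor products. -/
noncomputable def Chart.baseChange (c : Chart k 𝒳 j r X) :
    BaseChange 𝒳 (Spec.map (CommRingCat.ofHom (algebraMap A D)) ≫ j) where
  P := Spec (.of (D ⊗[A] X.B))
  PM := Spec (.of (D ⊗[A] X.M))
  fst := _
  snd := Spec.map (CommRingCat.ofHom (algebraMap D (D ⊗[A] X.B)))
  sq := (isPullback_Spec_tensor D X.B).paste_horiz c.sq
  fstM := _
  sndM := Spec.map (CommRingCat.ofHom (algebraMap D (D ⊗[A] X.M)))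
  sqM := (isPullback_Spec_tensor D X.M).paste_horiz c.sqM

variable (c : Chart k 𝒳 j r X) (c' : Chart k 𝒳' j r X')

theorem Spec_map_ofHom_comp {S S' S'' : Type u} [CommRing S] [CommRing S'] [CommRing S'']
    (f : S →+* S') (g : S' →+* S'') :
    Spec.map (CommRingCat.ofHom g) ≫ Spec.map (CommRingCat.ofHom f) =
      Spec.map (CommRingCat.ofHom (g.comp f)) := by
  rw [← Spec.map_comp]
  rfl

theorem Chart.baseChange_act : (c.baseChange D).act =
    Spec.map (CommRingCat.ofHom (Algebra.TensorProduct.map (.id D D) X.a).toRingHom) := by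
  refine (c.baseChange D).sq.hom_ext ?_ ?_
  · rw [BaseChange.act_fst]
    change (Spec.map _ ≫ c.lM) ≫ 𝒳.a = Spec.map _ ≫ Spec.map _ ≫ c.l
    rw [Category.assoc, ← c.comm_a, ← Category.assoc, ← Category.assoc, Spec_map_ofHom_comp,
      Spec_map_ofHom_comp]
    congr 3
  · rw [BaseChange.act_snd]
    change Spec.map _ = Spec.map _ ≫ Spec.map _
    rw [Spec_map_ofHom_comp]
    congr 2
    ext d
    simp [Algebra.TensorProduct.algebraMap_apply]

theorem Chart.baseChange_proj : (c.baseChange D).proj =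
    Spec.map (CommRingCat.ofHom (Algebra.TensorProduct.map (.id D D) X.s).toRingHom) := by
  refine (c.baseChange D).sq.hom_ext ?_ ?_
  · rw [BaseChange.proj_fst]
    change (Spec.map _ ≫ c.lM) ≫ 𝒳.s = Spec.map _ ≫ Spec.map _ ≫ c.l
    rw [Category.assoc, ← c.comm_s, ← Category.assoc, ← Category.assoc, Spec_map_ofHom_comp,
      Spec_map_ofHom_comp]
    congr 3
  · rw [BaseChange.proj_snd]
    change Spec.map _ = Spec.map _ ≫ Spec.map _
    rw [Spec_map_ofHom_comp]
    congr 2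
    ext d
    simp [Algebra.TensorProduct.algebraMap_apply]

theorem Chart.baseChange_mark : (c.baseChange D).fstM ≫ 𝒳.g = Spec.map (CommRingCat.ofHom
    ((Algebra.TensorProduct.includeRight : X.M →ₐ[A] D ⊗[A] X.M).toRingHom.comp c.ρ)) := by
  change (Spec.map _ ≫ c.lM) ≫ 𝒳.g = _
  rw [Category.assoc, ← c.comm_g, Spec_map_ofHom_comp]

theorem exists_ringHom_of_Spec_hom {S S' : Type u} [CommRing S] [CommRing S']
    (f : Spec (.of S') ⟶ Spec (.of S)) : ∃ φ : S →+* S', f = Spec.map (CommRingCat.ofHom φ) :=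
  ⟨(Spec.preimage f).hom, (Spec.map_preimage f).symm⟩

theorem Spec_map_ofHom_injective {S S' : Type u} [CommRing S] [CommRing S'] {f g : S →+* S'}
    (h : Spec.map (CommRingCat.ofHom f) = Spec.map (CommRingCat.ofHom g)) : f = g :=
  congrArg CommRingCat.Hom.hom (Spec.map_injective h)

variable {D} in
theorem exists_algHom_of_Spec_hom {B C : Type u} [CommRing B] [CommRing C] [Algebra A B]
    [Algebra A C] (f : Spec (.of (D ⊗[A] C)) ⟶ Spec (.of (D ⊗[A] B)))
    (hf : f ≫ Spec.map (CommRingCat.ofHom (algebraMap D (D ⊗[A] B))) =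
      Spec.map (CommRingCat.ofHom (algebraMap D (D ⊗[A] C)))) :
    ∃ φ : B →ₐ[A] D ⊗[A] C, f = Spec.map (CommRingCat.ofHom (extend φ).toRingHom) := by
  obtain ⟨ε, rfl⟩ := exists_ringHom_of_Spec_hom f
  rw [Spec_map_ofHom_comp] at hf
  have h := Spec_map_ofHom_injective hf
  let ε' : D ⊗[A] B →ₐ[D] D ⊗[A] C := ⟨ε, fun d => RingHom.congr_fun h d⟩
  refine ⟨(ε'.restrictScalars A).comp Algebra.TensorProduct.includeRight, ?_⟩
  congr 2
  refine tensor_ringHom_ext (fun d => ?_) fun b => ?_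
  · exact (ε'.commutes d).trans
      ((extend ((ε'.restrictScalars A).comp Algebra.TensorProduct.includeRight)).commutes d).symm
  · exact (extend_one_tmul
      ((ε'.restrictScalars A).comp Algebra.TensorProduct.includeRight) b).symm

theorem Chart.exists_baseChangeHom (i : (c'.baseChange D).Iso (c.baseChange D)) :
    ∃ f : BaseChangeHom X X' D,
      i.e.hom = Spec.map (CommRingCat.ofHom (extend f.φ).toRingHom) ∧
      i.eM.hom = Spec.map (CommRingCat.ofHom (extend f.Φ).toRingHom) := by
  obtain ⟨φ, hφ⟩ := exists_algHom_of_Spec_hom i.e.hom i.e_snd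
  obtain ⟨Φ, hΦ⟩ := exists_algHom_of_Spec_hom i.eM.hom i.eM_snd
  have ha := i.e_act
  have hs := i.e_proj
  have hm := i.e_mark
  rw [hφ, hΦ, c.baseChange_act D, c'.baseChange_act D] at ha
  rw [hφ, hΦ, c.baseChange_proj D, c'.baseChange_proj D] at hs
  rw [hΦ, c.baseChange_mark D, c'.baseChange_mark D] at hm
  have ha' := Spec_map_ofHom_injective
    ((Spec_map_ofHom_comp _ _).symm.trans (ha.trans (Spec_map_ofHom_comp _ _)))
  have hs' := Spec_map_ofHom_injective
    ((Spec_map_ofHom_comp _ _).symm.trans (hs.trans (Spec_map_ofHom_comp _ _)))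
  have hm' := Spec_map_ofHom_injective ((Spec_map_ofHom_comp _ _).symm.trans hm)
  refine ⟨⟨φ, Φ, fun b => ?_, fun b => ?_, fun i => ?_⟩, hφ, hΦ⟩
  · have := RingHom.congr_fun ha' (1 ⊗ₜ b)
    change extend Φ (Algebra.TensorProduct.map (.id D D) X.a (1 ⊗ₜ b)) =
      Algebra.TensorProduct.map (.id D D) X'.a (extend φ (1 ⊗ₜ b)) at this
    rw [Algebra.TensorProduct.map_tmul, map_one, extend_one_tmul, extend_one_tmul] at this
    exact this
  · have := RingHom.congr_fun hs' (1 ⊗ₜ b)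
    change extend Φ (Algebra.TensorProduct.map (.id D D) X.s (1 ⊗ₜ b)) =
      Algebra.TensorProduct.map (.id D D) X'.s (extend φ (1 ⊗ₜ b)) at this
    rw [Algebra.TensorProduct.map_tmul, map_one, extend_one_tmul, extend_one_tmul] at this
    exact this
  · have := RingHom.congr_fun hm' (r i)
    change extend Φ (1 ⊗ₜ c.ρ (r i)) = 1 ⊗ₜ c'.ρ (r i) at this
    rwa [c.ρ_mark, c'.ρ_mark, extend_one_tmul] at this

/-- An isomorphism of the base changes to `D` is given by homomorphisms of algebras. -/
theorem Chart.becomeIso (i : (c.baseChange D).Iso (c'.baseChange D)) : BecomeIso X X' D := by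
  obtain ⟨g, hg, hG⟩ := c'.exists_baseChangeHom D c i
  obtain ⟨f, hf, hF⟩ := c.exists_baseChangeHom D c' i.symm
  have key {B C : Type u} [CommRing B] [CommRing C] [Algebra A B] [Algebra A C]
      {φ : B →ₐ[A] D ⊗[A] C} {ψ : C →ₐ[A] D ⊗[A] B}
      (e : Spec (.of (D ⊗[A] B)) ≅ Spec (.of (D ⊗[A] C)))
      (h1 : e.hom = Spec.map (CommRingCat.ofHom (extend ψ).toRingHom))
      (h2 : e.inv = Spec.map (CommRingCat.ofHom (extend φ).toRingHom)) (b : B) :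
      extend ψ (φ b) = 1 ⊗ₜ b := by
    have h := e.hom_inv_id
    rw [h1, h2, Spec_map_ofHom_comp] at h
    have h' := Spec_map_ofHom_injective (g := RingHom.id _) (h.trans (Spec.map_id _).symm)
    have := RingHom.congr_fun h' (1 ⊗ₜ b)
    change extend ψ (extend φ (1 ⊗ₜ b)) = 1 ⊗ₜ b at this
    rwa [extend_one_tmul] at this
  exact ⟨f, g, key i.e hg hf, key i.e.symm hf hg, key i.eM hG hF, key i.eM.symm hF hG⟩

/-- The isomorphism of spectra given by mutually inverse homomorphisms. -/
noncomputable def specIso {B C : Type u} [CommRing B] [CommRing C] [Algebra A B] [Algebra A C]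
    (φ : B →ₐ[A] D ⊗[A] C) (ψ : C →ₐ[A] D ⊗[A] B) (h : ∀ b, extend ψ (φ b) = 1 ⊗ₜ b)
    (h' : ∀ c, extend φ (ψ c) = 1 ⊗ₜ c) : Spec (.of (D ⊗[A] B)) ≅ Spec (.of (D ⊗[A] C)) :=
  have key {B C : Type u} [CommRing B] [CommRing C] [Algebra A B] [Algebra A C]
      {φ : B →ₐ[A] D ⊗[A] C} {ψ : C →ₐ[A] D ⊗[A] B} (h : ∀ b, extend ψ (φ b) = 1 ⊗ₜ b) :
      Spec.map (CommRingCat.ofHom (extend ψ).toRingHom) ≫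
        Spec.map (CommRingCat.ofHom (extend φ).toRingHom) = 𝟙 _ := by
    rw [Spec_map_ofHom_comp]
    refine Eq.trans ?_ (Spec.map_id (R := .of (D ⊗[A] B)))
    congr 1
    refine congrArg CommRingCat.ofHom
      (tensor_ringHom_ext (g := RingHom.id _) (fun d => ?_) fun b => ?_)
    · simp
    · simp [h]
  ⟨_, _, key h, key h'⟩

/-- Conversely, an isomorphism of algebras over `D` gives one of schemes. The functions `r` have to
generate `R`, so that the marked elements determine the morphism to `Spec R`. -/
theorem Chart.nonempty_iso (hr : Algebra.adjoin k (Set.range r) = ⊤) (h : BecomeIso X X' D) :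
    Nonempty ((c.baseChange D).Iso (c'.baseChange D)) := by
  obtain ⟨f, g, h1, h2, h3, h4⟩ := h
  refine ⟨⟨specIso D f.φ g.φ h1 h2, specIso D f.Φ g.Φ h3 h4, ?_, ?_, ?_, ?_, ?_⟩⟩
  · change Spec.map _ ≫ Spec.map _ = Spec.map _
    rw [Spec_map_ofHom_comp]
    congr 2
    exact (extend g.φ).comp_algebraMap
  · change Spec.map _ ≫ Spec.map _ = Spec.map _
    rw [Spec_map_ofHom_comp]
    congr 2
    exact (extend g.Φ).comp_algebraMap
  · rw [c.baseChange_act D, c'.baseChange_act D]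
    change Spec.map _ ≫ Spec.map _ = Spec.map _ ≫ Spec.map _
    rw [Spec_map_ofHom_comp, Spec_map_ofHom_comp]
    congr 2
    refine tensor_ringHom_ext (fun d => by simp) fun b => ?_
    change extend g.Φ (Algebra.TensorProduct.map (.id D D) X'.a (1 ⊗ₜ b)) =
      Algebra.TensorProduct.map (.id D D) X.a (extend g.φ (1 ⊗ₜ b))
    rw [Algebra.TensorProduct.map_tmul, map_one, extend_one_tmul, extend_one_tmul]
    exact g.comp_a b
  · rw [c.baseChange_proj D, c'.baseChange_proj D]
    change Spec.map _ ≫ Spec.map _ = Spec.map _ ≫ Spec.map _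
    rw [Spec_map_ofHom_comp, Spec_map_ofHom_comp]
    congr 2
    refine tensor_ringHom_ext (fun d => by simp) fun b => ?_
    change extend g.Φ (Algebra.TensorProduct.map (.id D D) X'.s (1 ⊗ₜ b)) =
      Algebra.TensorProduct.map (.id D D) X.s (extend g.φ (1 ⊗ₜ b))
    rw [Algebra.TensorProduct.map_tmul, map_one, extend_one_tmul, extend_one_tmul]
    exact g.comp_s b
  · rw [c.baseChange_mark D, c'.baseChange_mark D]
    change Spec.map _ ≫ Spec.map _ = Spec.map _
    rw [Spec_map_ofHom_comp]
    congr 2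
    refine ringHom_ext_of_adjoin_eq_top hr (fun x => ?_) ?_
    · simp [c.ρ_algebraMap, c'.ρ_algebraMap]
    · rintro _ ⟨i, rfl⟩
      change extend g.Φ (1 ⊗ₜ c'.ρ (r i)) = 1 ⊗ₜ c.ρ (r i)
      rw [c.ρ_mark, c'.ρ_mark, extend_one_tmul, g.comp_mark]

end Charts

section ChartExistence

/-- The base change of an affine morphism of finite type to a noetherian affine scheme is the
spectrum of a finitely presented algebra. -/
theorem exists_isPullback_Spec {A : Type u} [CommRing A] [IsNoetherianRing A] {X Y : Scheme.{u}}
    (q : X ⟶ Y) [IsAffineHom q] [LocallyOfFiniteType q] (j : Spec (.of A) ⟶ Y) :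
    ∃ (B : Type u) (_ : CommRing B) (_ : Algebra A B) (_ : Algebra.FinitePresentation A B)
      (l : Spec (.of B) ⟶ X),
      IsPullback l (Spec.map (CommRingCat.ofHom (algebraMap A B))) q j := by
  have : IsAffine (pullback q j) := isAffine_of_isAffineHom (pullback.snd q j)
  let P := pullback q j
  let i : P ≅ Spec (.of Γ(P, ⊤)) := P.isoSpec
  obtain ⟨φ, hφ⟩ := exists_ringHom_of_Spec_hom (i.inv ≫ pullback.snd q j)
  have hft : LocallyOfFiniteType (Spec.map (CommRingCat.ofHom φ)) := by
    rw [← hφ]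
    infer_instance
  have hft' : φ.FiniteType :=
    (HasRingHomProperty.Spec_iff (P := @LocallyOfFiniteType) (φ := CommRingCat.ofHom φ)).1 hft
  let _ : Algebra A Γ(P, ⊤) := φ.toAlgebra
  have : Algebra.FiniteType A Γ(P, ⊤) := hft'
  refine ⟨Γ(P, ⊤), inferInstance, inferInstance,
    Algebra.FinitePresentation.of_finiteType.1 inferInstance, i.inv ≫ pullback.fst q j, ?_⟩
  refine IsPullback.of_iso (IsPullback.of_hasPullback q j) i (.refl _) (.refl _) (.refl _)
    (by simp [P]) ?_ (by simp) (by simp)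
  change pullback.snd q j ≫ 𝟙 _ = i.hom ≫ Spec.map (CommRingCat.ofHom φ)
  rw [← hφ]
  simp [P]

theorem exists_algHom_of_Spec_hom_over {A B C : Type u} [CommRing A] [CommRing B] [CommRing C]
    [Algebra A B] [Algebra A C] (f : Spec (.of C) ⟶ Spec (.of B))
    (hf : f ≫ Spec.map (CommRingCat.ofHom (algebraMap A B)) =
      Spec.map (CommRingCat.ofHom (algebraMap A C))) :
    ∃ φ : B →ₐ[A] C, f = Spec.map (CommRingCat.ofHom φ.toRingHom) := by
  obtain ⟨ε, rfl⟩ := exists_ringHom_of_Spec_hom f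
  rw [Spec_map_ofHom_comp] at hf
  exact ⟨⟨ε, RingHom.congr_fun (Spec_map_ofHom_injective hf)⟩, rfl⟩

variable {k A R : Type u} [CommRing k] [CommRing A] [IsNoetherianRing A] [CommRing R]
  [Algebra k A] [Algebra k R] {κ : Type*} {Y : Scheme.{u}}

/-- Charts exist over every affine scheme over `Y`: the base changes of `X` and `M` are affine. -/
theorem exists_chart (π : Y ⟶ Spec (.of k)) (j : Spec (.of A) ⟶ Y)
    (hj : j ≫ π = Spec.map (CommRingCat.ofHom (algebraMap k A)))
    (𝒳 : ActionDiagram Y (Spec (.of R))) [IsAffineHom 𝒳.p] [IsAffineHom 𝒳.s]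
    [LocallyOfFiniteType 𝒳.p] [LocallyOfFiniteType 𝒳.s]
    (hg : 𝒳.g ≫ Spec.map (CommRingCat.ofHom (algebraMap k R)) = 𝒳.s ≫ 𝒳.p ≫ π) (r : κ → R) :
    ∃ X : ActionAlgebra A κ, Nonempty (Chart k 𝒳 j r X) := by
  obtain ⟨B, _, _, _, l, sq⟩ := exists_isPullback_Spec 𝒳.p j
  obtain ⟨M, _, _, _, lM, sqM⟩ := exists_isPullback_Spec (𝒳.s ≫ 𝒳.p) j
  have key (u : 𝒳.M ⟶ 𝒳.X) (hu : u ≫ 𝒳.p = 𝒳.s ≫ 𝒳.p) : ∃ φ : B →ₐ[A] M,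
      Spec.map (CommRingCat.ofHom φ.toRingHom) ≫ l = lM ≫ u := by
    have hw : (lM ≫ u) ≫ 𝒳.p = Spec.map (CommRingCat.ofHom (algebraMap A M)) ≫ j := by
      rw [Category.assoc, hu, sqM.w]
    obtain ⟨φ, hφ⟩ := exists_algHom_of_Spec_hom_over (sq.lift _ _ hw) (sq.lift_snd _ _ hw)
    exact ⟨φ, by rw [← hφ, sq.lift_fst]⟩
  obtain ⟨a, ha⟩ := key 𝒳.a 𝒳.w
  obtain ⟨s, hs⟩ := key 𝒳.s rfl
  obtain ⟨ρ, hρ⟩ := exists_ringHom_of_Spec_hom (lM ≫ 𝒳.g)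
  have hρk : ρ.comp (algebraMap k R) = (algebraMap A M).comp (algebraMap k A) := by
    apply Spec_map_ofHom_injective
    rw [← Spec_map_ofHom_comp, ← Spec_map_ofHom_comp, ← hρ, ← hj, Category.assoc, hg,
      ← Category.assoc 𝒳.s, ← Category.assoc, sqM.w, Category.assoc]
  exact ⟨⟨B, M, a, s, fun i => ρ (r i)⟩, ⟨l, sq, lM, sqM, ha, hs, ρ, hρ.symm,
    RingHom.congr_fun hρk, fun _ => rfl⟩⟩

end ChartExistence

/-! ### The theorem near a generic point of the base -/

section Local

/-- The scheme-theoretic statement over an integral affine scheme mapping to `Y`. -/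
theorem exists_iso_of_affine {F k : Type u} [Field F] [Field k] [Algebra F k] [IsAlgClosed k]
    (hk : Cardinal.aleph0 ≤ Algebra.trdeg F k)
    {A R : Type u} [CommRing A] [IsDomain A] [Algebra k A] [Algebra.FiniteType k A] [CommRing R]
    [Algebra k R] [Algebra.FiniteType k R] {Y : Scheme.{u}} (π : Y ⟶ Spec (.of k))
    (j : Spec (.of A) ⟶ Y) (hj : j ≫ π = Spec.map (CommRingCat.ofHom (algebraMap k A)))
    (𝒳 𝒳' : ActionDiagram Y (Spec (.of R))) [IsAffineHom 𝒳.p] [IsAffineHom 𝒳.s]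
    [LocallyOfFiniteType 𝒳.p] [LocallyOfFiniteType 𝒳.s] [IsAffineHom 𝒳'.p] [IsAffineHom 𝒳'.s]
    [LocallyOfFiniteType 𝒳'.p] [LocallyOfFiniteType 𝒳'.s]
    (hg : 𝒳.g ≫ Spec.map (CommRingCat.ofHom (algebraMap k R)) = 𝒳.s ≫ 𝒳.p ≫ π)
    (hg' : 𝒳'.g ≫ Spec.map (CommRingCat.ofHom (algebraMap k R)) = 𝒳'.s ≫ 𝒳'.p ≫ π)
    (h : ∀ y : Spec (.of k) ⟶ Y, y ≫ π = 𝟙 _ →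
      ∃ (β : BaseChange 𝒳 y) (β' : BaseChange 𝒳' y), Nonempty (β.Iso β')) :
    ∃ (D : Type u) (_ : CommRing D) (_ : IsDomain D) (_ : Algebra A D),
      Algebra.FiniteType A D ∧ Function.Injective (algebraMap A D) ∧ Algebra.QuasiFinite A D ∧
      (CharZero k → Algebra.Etale A D) ∧
      ∃ (β : BaseChange 𝒳 (Spec.map (CommRingCat.ofHom (algebraMap A D)) ≫ j))
        (β' : BaseChange 𝒳' (Spec.map (CommRingCat.ofHom (algebraMap A D)) ≫ j)),
        Nonempty (β.Iso β') := by
  have : IsNoetherianRing A := Algebra.FiniteType.isNoetherianRing k A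
  obtain ⟨r, hr⟩ := (inferInstance : Algebra.FiniteType k R).out
  let r' : r → R := Subtype.val
  have hr' : Algebra.adjoin k (Set.range r') = ⊤ := by
    rw [← hr]
    simp [r']
  obtain ⟨X, ⟨c⟩⟩ := exists_chart π j hj 𝒳 hg r'
  obtain ⟨X', ⟨c'⟩⟩ := exists_chart π j hj 𝒳' hg' r'
  obtain ⟨D, _, _, _, h1, h2, h3, h4, h5⟩ := exists_becomeIso hk X X' fun y => by
    let _ := y.toRingHom.toAlgebra
    have hy : y.toRingHom.comp (algebraMap k A) = RingHom.id k := y.comp_algebraMap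
    obtain ⟨β, β', ⟨i⟩⟩ := h (Spec.map (CommRingCat.ofHom (algebraMap A k)) ≫ j) (by
      rw [Category.assoc, hj, Spec_map_ofHom_comp]
      change Spec.map (CommRingCat.ofHom (y.toRingHom.comp (algebraMap k A))) = _
      rw [hy]
      exact Spec.map_id _)
    obtain ⟨i'⟩ := i.transfer (c.baseChange k) (c'.baseChange k)
    exact c.becomeIso k c' i'
  exact ⟨D, inferInstance, inferInstance, inferInstance, h1, h2, h3, h4, c.baseChange D,
    c'.baseChange D, c.nonempty_iso D c' hr' h5⟩

end Local

/-! ### The theorem over a reduced base -/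

section Global

/-- An irreducible component of a noetherian reduced scheme is the closure of an integral affine
open subscheme. -/
theorem exists_integral_affine_chart {Y : Scheme.{u}} [IsNoetherian Y] [IsReduced Y]
    {Z : Set Y} (hZ : Z ∈ irreducibleComponents Y) :
    ∃ (A : Type u) (_ : CommRing A) (_ : IsDomain A) (j : Spec (.of A) ⟶ Y),
      IsOpenImmersion j ∧ Z ⊆ closure (Set.range j) := by
  obtain ⟨O, hO, ⟨x, hx⟩, hOZ⟩ :=
    TopologicalSpace.NoetherianSpace.exists_isOpen_nonempty_subset_irreducibleComponent Z hZ
  obtain ⟨_, ⟨W : Y.Opens, hW, rfl⟩, hxW, hWO⟩ :=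
    Y.isBasis_affineOpens.exists_subset_of_mem_open hx hO
  have hW' : IsAffineOpen W := hW
  have hcl : Z ⊆ closure (W : Set Y) :=
    (subset_closure_inter_of_isPreirreducible_of_isOpen hZ.1.2 W.2 ⟨x, hOZ hx, hxW⟩).trans
      (closure_mono Set.inter_subset_right)
  have hirr : IsIrreducible (W : Set Y) :=
    ⟨⟨x, hxW⟩, hZ.1.2.open_subset W.2 (hWO.trans hOZ)⟩
  have : IrreducibleSpace W := isIrreducible_iff_irreducibleSpace.mp hirr
  have : AlgebraicGeometry.IsIntegral W := isIntegral_of_irreducibleSpace_of_isReduced _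
  have : IsAffine W := hW'
  have : Nonempty W := ⟨⟨x, hxW⟩⟩
  refine ⟨Γ(W, ⊤), inferInstance, inferInstance, (W : Scheme).isoSpec.inv ≫ W.ι, inferInstance,
    ?_⟩
  refine hcl.trans (closure_mono ?_)
  rw [← W.range_ι]
  rintro _ ⟨y, rfl⟩
  exact ⟨(W : Scheme).isoSpec.hom y, by simp [← Scheme.Hom.comp_apply]⟩

theorem denseRange_Spec_map {A D : Type u} [CommRing A] [CommRing D] [Algebra A D]
    (h : Function.Injective (algebraMap A D)) :
    DenseRange (Spec.map (CommRingCat.ofHom (algebraMap A D))) := by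
  have := (PrimeSpectrum.denseRange_comap_iff_ker_le_nilRadical (algebraMap A D)).2
    (by rw [(RingHom.injective_iff_ker_eq_bot _).1 h]; exact bot_le)
  exact this

/-- The scheme-theoretic statement over a reduced scheme of finite type over `k`. -/
theorem exists_iso_of_isReduced {F k : Type u} [Field F] [Field k] [Algebra F k] [IsAlgClosed k]
    (hk : Cardinal.aleph0 ≤ Algebra.trdeg F k)
    {R : Type u} [CommRing R] [Algebra k R] [Algebra.FiniteType k R] {Y : Scheme.{u}} [IsReduced Y]
    (π : Y ⟶ Spec (.of k)) [LocallyOfFiniteType π] [QuasiCompact π]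
    (𝒳 𝒳' : ActionDiagram Y (Spec (.of R))) [IsAffineHom 𝒳.p] [IsAffineHom 𝒳.s]
    [LocallyOfFiniteType 𝒳.p] [LocallyOfFiniteType 𝒳.s] [IsAffineHom 𝒳'.p] [IsAffineHom 𝒳'.s]
    [LocallyOfFiniteType 𝒳'.p] [LocallyOfFiniteType 𝒳'.s]
    (hg : 𝒳.g ≫ Spec.map (CommRingCat.ofHom (algebraMap k R)) = 𝒳.s ≫ 𝒳.p ≫ π)
    (hg' : 𝒳'.g ≫ Spec.map (CommRingCat.ofHom (algebraMap k R)) = 𝒳'.s ≫ 𝒳'.p ≫ π)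
    (h : ∀ y : Spec (.of k) ⟶ Y, y ≫ π = 𝟙 _ →
      ∃ (β : BaseChange 𝒳 y) (β' : BaseChange 𝒳' y), Nonempty (β.Iso β')) :
    ∃ (U : Scheme.{u}) (φ : U ⟶ Y), IsReduced U ∧ IsAffine U ∧ LocallyOfFiniteType φ ∧
      IsDominant φ ∧ LocallyQuasiFinite φ ∧ (CharZero k → Etale φ) ∧
      ∃ (β : BaseChange 𝒳 φ) (β' : BaseChange 𝒳' φ), Nonempty (β.Iso β') := by
  have : IsLocallyNoetherian Y := LocallyOfFiniteType.isLocallyNoetherian π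
  have : CompactSpace Y := (quasiCompact_iff_compactSpace (f := π)).1 inferInstance
  have : IsNoetherian Y := {}
  -- The statement near the generic point of each irreducible component.
  have hloc (Z : irreducibleComponents Y) : ∃ (U : Scheme.{u}) (φ : U ⟶ Y), IsReduced U ∧
      IsAffine U ∧ LocallyOfFiniteType φ ∧ (Z : Set Y) ⊆ closure (Set.range φ) ∧
      LocallyQuasiFinite φ ∧ (CharZero k → Etale φ) ∧
      ∃ (β : BaseChange 𝒳 φ) (β' : BaseChange 𝒳' φ), Nonempty (β.Iso β') := by
    obtain ⟨A, _, _, j, hj, hZ⟩ := exists_integral_affine_chart Z.2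
    obtain ⟨ρ, hρ⟩ := exists_ringHom_of_Spec_hom (j ≫ π)
    have hft : LocallyOfFiniteType (Spec.map (CommRingCat.ofHom ρ)) := by
      rw [← hρ]
      infer_instance
    have hft' : ρ.FiniteType :=
      (HasRingHomProperty.Spec_iff (P := @LocallyOfFiniteType) (φ := CommRingCat.ofHom ρ)).1 hft
    let _ : Algebra k A := ρ.toAlgebra
    have : Algebra.FiniteType k A := hft'
    obtain ⟨D, _, _, _, hD, hinj, hqf, het, hβ⟩ :=
      exists_iso_of_affine hk π j hρ 𝒳 𝒳' hg hg' h
    have h1 : LocallyOfFiniteType (Spec.map (CommRingCat.ofHom (algebraMap A D))) :=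
      (HasRingHomProperty.Spec_iff (P := @LocallyOfFiniteType)).2
        (by simpa [RingHom.finiteType_algebraMap] using hD)
    have h2 : LocallyQuasiFinite (Spec.map (CommRingCat.ofHom (algebraMap A D))) :=
      (HasRingHomProperty.Spec_iff (P := @LocallyQuasiFinite)).2
        (by simpa [RingHom.quasiFinite_algebraMap] using hqf)
    refine ⟨Spec (.of D), Spec.map (CommRingCat.ofHom (algebraMap A D)) ≫ j, inferInstance,
      inferInstance, inferInstance, ?_, inferInstance, fun h0 => ?_, hβ⟩
    · refine hZ.trans (closure_minimal ?_ isClosed_closure)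
      rintro _ ⟨y, rfl⟩
      have := (j.continuous.range_subset_closure_image_dense (denseRange_Spec_map hinj)) ⟨y, rfl⟩
      rwa [← Set.range_comp] at this
    · have : Etale (Spec.map (CommRingCat.ofHom (algebraMap A D))) :=
        (HasRingHomProperty.Spec_iff (P := @Etale)).2
          (by simpa [RingHom.etale_algebraMap] using het h0)
      infer_instance
  have hfin : Finite (irreducibleComponents Y) :=
    TopologicalSpace.NoetherianSpace.finite_irreducibleComponents
  let c := Finite.equivFin (irreducibleComponents Y)
  choose U φ hred haff hft hdom hqf het β β' i using fun m => hloc (c.symm m)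
  have : IsZariskiLocalAtSource (@LocallyOfFiniteType.{u}) :=
    HasRingHomProperty.instIsZariskiLocalAtSource
  have : IsZariskiLocalAtSource (@LocallyQuasiFinite.{u}) :=
    HasRingHomProperty.instIsZariskiLocalAtSource
  have : IsZariskiLocalAtSource (@Etale.{u}) :=
    HasRingHomProperty.instIsZariskiLocalAtSource
  refine ⟨∐ U, Limits.Sigma.desc φ, ?_, inferInstance,
    IsZariskiLocalAtSource.sigmaDesc (P := @LocallyOfFiniteType.{u}) hft, ⟨fun y => ?_⟩,
    IsZariskiLocalAtSource.sigmaDesc (P := @LocallyQuasiFinite.{u}) hqf,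
    fun h0 => IsZariskiLocalAtSource.sigmaDesc (P := @Etale.{u}) fun m => het m h0,
    .sigma β, .sigma β',
    ⟨.sigma fun m => (i m).some⟩⟩
  · exact @IsReduced.of_openCover _ (sigmaOpenCover U) hred
  let Z : irreducibleComponents Y :=
    ⟨irreducibleComponent y, irreducibleComponent_mem_irreducibleComponents y⟩
  have hy : y ∈ closure (Set.range (φ (c Z))) :=
    hdom (c Z) (by rw [c.symm_apply_apply]; exact mem_irreducibleComponent)
  refine closure_mono ?_ hy
  rintro _ ⟨x, rfl⟩
  exact ⟨Limits.Sigma.ι U (c Z) x, by rw [← Scheme.Hom.comp_apply, Limits.Sigma.ι_desc]⟩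

end Global

/-! ### Equivariant isomorphisms and isomorphisms of diagrams of actions -/

section Functors

universe v₁ v₂ u₁ u₂

variable {E : Type u₁} [Category.{v₁} E] {E' : Type u₂} [Category.{v₂} E']

/-- The image of a diagram under a functor. -/
def ActionDiagram.map {Y N : E} (𝒳 : ActionDiagram Y N) (F : E ⥤ E') :
    ActionDiagram (F.obj Y) (F.obj N) where
  X := F.obj 𝒳.X
  M := F.obj 𝒳.M
  p := F.map 𝒳.p
  a := F.map 𝒳.a
  s := F.map 𝒳.s
  w := by rw [← F.map_comp, 𝒳.w, F.map_comp]
  g := F.map 𝒳.g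

namespace BaseChange

/-- The image of a base change under a functor that preserves pullbacks. -/
def map {Y N U : E} {𝒳 : ActionDiagram Y N} {f : U ⟶ Y} (β : BaseChange 𝒳 f) (F : E ⥤ E')
    [PreservesLimitsOfShape WalkingCospan F] : BaseChange (𝒳.map F) (F.map f) where
  P := F.obj β.P
  PM := F.obj β.PM
  fst := F.map β.fst
  snd := F.map β.snd
  sq := β.sq.map F
  fstM := F.map β.fstM
  sndM := F.map β.sndM
  sqM := by simpa using! β.sqM.map F

section

variable {Y N U : E} {𝒳 𝒳' : ActionDiagram Y N} {f : U ⟶ Y} (F : E ⥤ E')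
    [PreservesLimitsOfShape WalkingCospan F]

theorem map_act (β : BaseChange 𝒳 f) : (β.map F).act = F.map β.act := by
  have h₁ : F.map β.fstM ≫ F.map 𝒳.a = F.map β.act ≫ F.map β.fst := by
    rw [← F.map_comp, ← F.map_comp, act_fst]
  have h₂ : F.map β.sndM = F.map β.act ≫ F.map β.snd := by
    rw [← F.map_comp, act_snd]
  exact (β.map F).sq.hom_ext ((act_fst _).trans h₁) ((act_snd _).trans h₂)

theorem map_proj (β : BaseChange 𝒳 f) : (β.map F).proj = F.map β.proj := by
  have h₁ : F.map β.fstM ≫ F.map 𝒳.s = F.map β.proj ≫ F.map β.fst := by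
    rw [← F.map_comp, ← F.map_comp, proj_fst]
  have h₂ : F.map β.sndM = F.map β.proj ≫ F.map β.snd := by
    rw [← F.map_comp, proj_snd]
  exact (β.map F).sq.hom_ext ((proj_fst _).trans h₁) ((proj_snd _).trans h₂)

/-- The image of an isomorphism of base changes. -/
def Iso.map {β : BaseChange 𝒳 f} {β' : BaseChange 𝒳' f} (i : Iso β β') :
    Iso (β.map F) (β'.map F) where
  e := F.mapIso i.e
  eM := F.mapIso i.eM
  e_snd := by simpa using! congrArg F.map i.e_snd
  eM_snd := by simpa using! congrArg F.map i.eM_snd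
  e_act := by simpa [map_act] using! congrArg F.map i.e_act
  e_proj := by simpa [map_proj] using! congrArg F.map i.e_proj
  e_mark := by simpa using! congrArg F.map i.e_mark

end

/-- Isomorphisms of base changes lift along the forgetful functor of an over category. -/
theorem Iso.nonempty_of_forget {B : E} {Y N U : Over B} {𝒳 𝒳' : ActionDiagram Y N} {f : U ⟶ Y}
    {β : BaseChange 𝒳 f} {β' : BaseChange 𝒳' f}
    (i : Iso (β.map (Over.forget B)) (β'.map (Over.forget B))) : Nonempty (Iso β β') := by
  have he : i.e.hom ≫ β'.P.hom = β.P.hom := by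
    rw [← Over.w β'.snd, ← Over.w β.snd]
    exact (Category.assoc _ _ _).symm.trans (congrArg (· ≫ U.hom) i.e_snd)
  have heM : i.eM.hom ≫ β'.PM.hom = β.PM.hom := by
    rw [← Over.w β'.sndM, ← Over.w β.sndM]
    exact (Category.assoc _ _ _).symm.trans (congrArg (· ≫ U.hom) i.eM_snd)
  have hact := i.e_act
  have hproj := i.e_proj
  rw [map_act, map_act] at hact
  rw [map_proj, map_proj] at hproj
  exact ⟨{  e := Over.isoMk i.e he
            eM := Over.isoMk i.eM heM
            e_snd := Over.OverMorphism.ext i.e_snd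
            eM_snd := Over.OverMorphism.ext i.eM_snd
            e_act := Over.OverMorphism.ext hact
            e_proj := Over.OverMorphism.ext hproj
            e_mark := Over.OverMorphism.ext i.e_mark }⟩

end BaseChange

end Functors

section Actions

variable {C : Type*} [Category* C] [CartesianMonoidalCategory C]

/-- The diagram attached to an action of `G` on `X` over `Y`, restricted along a morphism
`W ⟶ G`. -/
def actionDiagram {G W X Y : C} [MonObj G] [ModObj G X] {p : X ⟶ Y} (hp : IsInvariant G p)
    (w : W ⟶ G) : ActionDiagram Y W where
  X := X
  M := W ⊗ X
  p := p
  a := (w ▷ X) ≫ γ[G, X]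
  s := snd W X
  w := by
    have h : γ[G, X] ≫ p = snd G X ≫ p := hp
    simp [h]
  g := fst W X

/-- A product with a fixed object commutes with pullbacks. -/
theorem isPullback_tensor (W : C) {X Y U P : C} {p : X ⟶ Y} {f : U ⟶ Y} {l : P ⟶ X} {r : P ⟶ U}
    (h : IsPullback l r p f) : IsPullback (W ◁ l) (snd W P ≫ r) (snd W X ≫ p) f := by
  refine ⟨⟨by simp [h.w]⟩, ⟨PullbackCone.IsLimit.mk _ (fun c => lift (c.fst ≫ fst W X)
    (h.lift (c.fst ≫ snd W X) c.snd (by simpa using c.condition))) (fun c => ?_) (fun c => ?_)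
    fun c m h1 h2 => ?_⟩⟩
  · ext <;> simp
  · simp
  · ext
    · simp [← h1]
    · simp only [lift_snd]
      refine h.hom_ext ?_ ?_
      · simp [← h1]
      · simp [← h2]

variable [HasPullbacks C]

/-- The base change given by the chosen pullbacks. -/
noncomputable def actionBaseChange {G W X Y U : C} [MonObj G] [ModObj G X] {p : X ⟶ Y}
    (hp : IsInvariant G p) (w : W ⟶ G) (f : U ⟶ Y) : BaseChange (actionDiagram hp w) f where
  P := pullback p f
  PM := W ⊗ pullback p f
  fst := pullback.fst p f
  snd := pullback.snd p f
  sq := .of_hasPullback p f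
  fstM := W ◁ pullback.fst p f
  sndM := snd W _ ≫ pullback.snd p f
  sqM := isPullback_tensor W (.of_hasPullback p f)

section

variable {G W X Y U : C} [MonObj G] [ModObj G X] {p : X ⟶ Y} (hp : IsInvariant G p) (w : W ⟶ G)
  (f : U ⟶ Y)

theorem pullbackAct_fst :
    pullbackAct G hp f ≫ pullback.fst p f = (G ◁ pullback.fst p f) ≫ γ[G, X] :=
  pullback.lift_fst ..

theorem pullbackAct_snd :
    pullbackAct G hp f ≫ pullback.snd p f = snd G (pullback p f) ≫ pullback.snd p f :=
  pullback.lift_snd ..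

theorem actionBaseChange_act :
    (actionBaseChange hp w f).act = (w ▷ pullback p f) ≫ pullbackAct G hp f := by
  have h₁ : (W ◁ pullback.fst p f) ≫ (w ▷ X) ≫ γ[G, X] =
      ((w ▷ pullback p f) ≫ pullbackAct G hp f) ≫ pullback.fst p f := by
    rw [Category.assoc, pullbackAct_fst, whisker_exchange_assoc]
  have h₂ : snd W (pullback p f) ≫ pullback.snd p f =
      ((w ▷ pullback p f) ≫ pullbackAct G hp f) ≫ pullback.snd p f := by
    simp [pullbackAct_snd]
  exact pullback.hom_ext ((BaseChange.act_fst _).trans h₁) ((BaseChange.act_snd _).trans h₂)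

theorem actionBaseChange_proj : (actionBaseChange hp w f).proj = snd W (pullback p f) := by
  have h₁ : (W ◁ pullback.fst p f) ≫ snd W X = snd W (pullback p f) ≫ pullback.fst p f := by simp
  exact pullback.hom_ext ((BaseChange.proj_fst _).trans h₁) (BaseChange.proj_snd _)

end

variable {G W X X' Y U : C} [MonObj G] [ModObj G X] [ModObj G X'] {p : X ⟶ Y} {q : X' ⟶ Y}
  (hp : IsInvariant G p) (hq : IsInvariant G q) (w : W ⟶ G) (f : U ⟶ Y)

/-- An equivariant isomorphism over the base is an isomorphism of diagrams. -/
noncomputable def isoOfIsEquivariant (e : pullback p f ≅ pullback q f)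
    (hf : e.hom ≫ pullback.snd q f = pullback.snd p f) (he : IsEquivariant G hp hq e.hom) :
    (actionBaseChange hp w f).Iso (actionBaseChange hq w f) where
  e := e
  eM := whiskerLeftIso W e
  e_snd := hf
  eM_snd := by simp [actionBaseChange, hf]
  e_act := by
    have h : pullbackAct G hp f ≫ e.hom = (G ◁ e.hom) ≫ pullbackAct G hq f := he
    have key : (W ◁ e.hom) ≫ (w ▷ pullback q f) ≫ pullbackAct G hq f =
        ((w ▷ pullback p f) ≫ pullbackAct G hp f) ≫ e.hom := by
      rw [Category.assoc, h, whisker_exchange_assoc]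
    rw [actionBaseChange_act, actionBaseChange_act]
    exact key
  e_proj := by
    have key : (W ◁ e.hom) ≫ snd W (pullback q f) = snd W (pullback p f) ≫ e.hom := by simp
    rw [actionBaseChange_proj, actionBaseChange_proj]
    exact key
  e_mark := by simp [actionBaseChange, actionDiagram]

/-- If `W × P ⟶ G × P` is an epimorphism, where `P` is the base change of `X`, then an isomorphism
of the diagrams restricted to `W` is equivariant: its component on `W × P` is determined by the
projections. -/
theorem isEquivariant_of_iso [Epi (w ▷ pullback p f)]
    (i : (actionBaseChange hp w f).Iso (actionBaseChange hq w f)) :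
    IsEquivariant G hp hq i.e.hom := by
  have hact := i.e_act
  have hproj := i.e_proj
  have hmark := i.e_mark
  rw [actionBaseChange_act, actionBaseChange_act] at hact
  rw [actionBaseChange_proj, actionBaseChange_proj] at hproj
  obtain ⟨e, he⟩ : ∃ e : pullback p f ⟶ pullback q f, e = i.e.hom := ⟨_, rfl⟩
  obtain ⟨m, hm⟩ : ∃ m : W ⊗ pullback p f ⟶ W ⊗ pullback q f, m = i.eM.hom := ⟨_, rfl⟩
  rw [← he] at hact hproj ⊢
  rw [← hm] at hact hproj hmark
  have h₁ : m ≫ (W ◁ pullback.fst q f) ≫ fst W X' = (W ◁ pullback.fst p f) ≫ fst W X := hmark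
  have h₂ : m ≫ snd W (pullback q f) = snd W (pullback p f) ≫ e := hproj
  have h₃ : m ≫ (w ▷ pullback q f) ≫ pullbackAct G hq f =
    ((w ▷ pullback p f) ≫ pullbackAct G hp f) ≫ e := hact
  -- `m` and `W ◁ e` have the same components on `W` and on the base change of `X'`.
  have hM : m = W ◁ e := by
    refine CartesianMonoidalCategory.hom_ext _ _ ?_ ?_
    · simpa using h₁
    · simpa using h₂
  rw [hM, whisker_exchange_assoc, Category.assoc] at h₃
  exact ((cancel_epi (w ▷ pullback p f)).1 h₃).symm

end Actions

/-! ### Algebraic groups and varieties -/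

section Varieties

/-- An algebraic group is the image of a flat morphism from an affine scheme of finite type, the
disjoint union of a finite affine open cover. -/
theorem exists_affine_cover {k : Type u} [Field k] (G : Over (Spec (.of k)))
    (h₁ : LocallyOfFiniteType G.hom) (h₂ : QuasiCompact G.hom) :
    ∃ (R : Type u) (_ : CommRing R) (_ : Algebra k R) (_ : Algebra.FiniteType k R)
      (w : Over.mk (Spec.map (CommRingCat.ofHom (algebraMap k R))) ⟶ G),
      Flat w.left ∧ Surjective w.left := by
  have : CompactSpace G.left := (quasiCompact_iff_compactSpace (f := G.hom)).1 h₂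
  have : IsZariskiLocalAtSource (@Etale.{u}) := HasRingHomProperty.instIsZariskiLocalAtSource
  have : MorphismProperty.ContainsIdentities (@Etale.{u}) :=
    ⟨fun X => (inferInstance : Etale (𝟙 X))⟩
  obtain ⟨W, c, hc, het, hW⟩ :=
    Scheme.exists_hom_isAffine_of_isZariskiLocalAtSource (P := @Etale.{u}) G.left
  obtain ⟨ρ, hρ⟩ := exists_ringHom_of_Spec_hom (W.isoSpec.inv ≫ c ≫ G.hom)
  have hft : LocallyOfFiniteType (Spec.map (CommRingCat.ofHom ρ)) := by
    rw [← hρ]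
    infer_instance
  have hft' : ρ.FiniteType :=
    (HasRingHomProperty.Spec_iff (P := @LocallyOfFiniteType) (φ := CommRingCat.ofHom ρ)).1 hft
  let _ : Algebra k Γ(W, ⊤) := ρ.toAlgebra
  refine ⟨Γ(W, ⊤), inferInstance, inferInstance, hft',
    Over.homMk (W.isoSpec.inv ≫ c) ((Category.assoc _ _ _).trans hρ), ?_, ?_⟩
  · change Flat (W.isoSpec.inv ≫ c)
    infer_instance
  · change Surjective (W.isoSpec.inv ≫ c)
    infer_instance

/-- A flat surjective morphism remains epimorphic after a product with any scheme over the base,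
since it remains flat and surjective. -/
theorem epi_whiskerRight {B : Scheme.{u}} {W G : Over B} (w : W ⟶ G) (P : Over B)
    (h₁ : Flat w.left) (h₂ : Surjective w.left) : Epi (w ▷ P) := by
  have h : IsPullback (w ▷ P).left (fst W P).left (fst G P).left w.left := by
    have h' : IsPullback (fst W P) (w ▷ P) w (fst G P) := by
      refine ⟨⟨by simp⟩, ⟨PullbackCone.IsLimit.mk _ (fun c => lift c.fst (c.snd ≫ snd G P))
        (fun c => by simp) (fun c => ?_) fun c m h1 h2 => ?_⟩⟩
      · have := c.condition
        ext1 <;> simp [this]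
      · ext1 <;> simp [← h1, ← h2]
    exact (h'.map (Over.forget B)).flip
  have : Flat (w ▷ P).left := MorphismProperty.of_isPullback h.flip h₁
  have : Surjective (w ▷ P).left := MorphismProperty.of_isPullback h.flip h₂
  have := Flat.epi_of_flat_of_surjective (w ▷ P).left
  exact Over.epi_of_epi_left _

variable {k : Type u} [Field k] {S Y G W : Over (Spec (.of k))} [GrpObj G] [ModObj G S]
  {p : S ⟶ Y}

/-- The diagram of schemes underlying an action over `k`. -/
noncomputable abbrev schemeDiagram (hp : IsInvariant G p) (w : W ⟶ G) :
    ActionDiagram Y.left W.left :=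
  (actionDiagram hp w).map (Over.forget _)

theorem isAffineHom_schemeDiagram_s (hp : IsInvariant G p) (w : W ⟶ G) [IsAffine W.left] :
    IsAffineHom (schemeDiagram hp w).s := by
  have : IsAffineHom W.hom := inferInstance
  exact MorphismProperty.of_isPullback (IsPullback.of_hasPullback W.hom S.hom) this

theorem locallyOfFiniteType_schemeDiagram_s (hp : IsInvariant G p) (w : W ⟶ G)
    [LocallyOfFiniteType W.hom] : LocallyOfFiniteType (schemeDiagram hp w).s := by
  change LocallyOfFiniteType (pullback.snd W.hom S.hom)
  infer_instance

theorem schemeDiagram_g_comp (hp : IsInvariant G p) (w : W ⟶ G) :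
    (schemeDiagram hp w).g ≫ W.hom = (schemeDiagram hp w).s ≫ (schemeDiagram hp w).p ≫ Y.hom := by
  have h : (fst W S).left ≫ W.hom = (snd W S).left ≫ p.left ≫ Y.hom := by
    rw [Over.w, Over.w, Over.w]
  exact h

/-- The equivariant statement, with an isomorphism of fibers over the base point at every
`k`-point. -/
theorem exists_equivariant_iso [IsAlgClosed k]
    (hk : Cardinal.aleph0 ≤ Algebra.trdeg (⊥ : Subfield k) k) {T : Over (Spec (.of k))}
    [ModObj G T] {q : T ⟶ Y} (hS : IsVariety S) (hT : IsVariety T) (hY : IsVariety Y)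
    (hpa : IsAffineHom p.left) (hqa : IsAffineHom q.left) (hG : LocallyOfFiniteType G.hom)
    (hG' : QuasiCompact G.hom) (hp : IsInvariant G p) (hq : IsInvariant G q)
    (h : ∀ y : 𝟙_ (Over (Spec (.of k))) ⟶ Y, ∃ e : pullback p y ≅ pullback q y,
      e.hom ≫ pullback.snd q y = pullback.snd p y ∧ IsEquivariant G hp hq e.hom) :
    ∃ (U : Over (Spec (.of k))) (φ : U ⟶ Y), IsVariety U ∧
      IsDominant φ.left ∧ LocallyQuasiFinite φ.left ∧ (CharZero k → Etale φ.left) ∧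
      ∃ e : pullback p φ ≅ pullback q φ, e.hom ≫ pullback.snd q φ = pullback.snd p φ ∧
        IsEquivariant G hp hq e.hom := by
  obtain ⟨R, _, _, _, w, hw₁, hw₂⟩ := exists_affine_cover G hG hG'
  let W := Over.mk (Spec.map (CommRingCat.ofHom (algebraMap k R)))
  have := hY.isReduced
  have := hY.locallyOfFiniteType
  have := hY.quasiCompact
  have := hS.locallyOfFiniteType
  have := hT.locallyOfFiniteType
  have : IsAffine W.left := inferInstanceAs (IsAffine (Spec (.of R)))
  have : LocallyOfFiniteType W.hom :=
    (HasRingHomProperty.Spec_iff (P := @LocallyOfFiniteType)).2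
      (by simpa [RingHom.finiteType_algebraMap])
  have : LocallyOfFiniteType p.left := by
    have : LocallyOfFiniteType (p.left ≫ Y.hom) := by rwa [Over.w]
    exact locallyOfFiniteType_of_comp p.left Y.hom
  have : LocallyOfFiniteType q.left := by
    have : LocallyOfFiniteType (q.left ≫ Y.hom) := by rwa [Over.w]
    exact locallyOfFiniteType_of_comp q.left Y.hom
  have : IsAffineHom (schemeDiagram hp w).p := hpa
  have : IsAffineHom (schemeDiagram hq w).p := hqa
  have : LocallyOfFiniteType (schemeDiagram hp w).p := ‹LocallyOfFiniteType p.left›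
  have : LocallyOfFiniteType (schemeDiagram hq w).p := ‹LocallyOfFiniteType q.left›
  have := isAffineHom_schemeDiagram_s hp w
  have := isAffineHom_schemeDiagram_s hq w
  have := locallyOfFiniteType_schemeDiagram_s hp w
  have := locallyOfFiniteType_schemeDiagram_s hq w
  obtain ⟨U, φ, hU, hUa, hft, hdom, hqf, het, β, β', ⟨i⟩⟩ :=
    exists_iso_of_isReduced hk Y.hom (schemeDiagram hp w) (schemeDiagram hq w)
      (schemeDiagram_g_comp hp w) (schemeDiagram_g_comp hq w) fun y hy => by
        let y' : 𝟙_ (Over (Spec (.of k))) ⟶ Y := Over.homMk y hy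
        obtain ⟨e, he, heq⟩ := h y'
        exact ⟨_, _, ⟨(isoOfIsEquivariant hp hq w y' e he heq).map (Over.forget _)⟩⟩
  let U' : Over (Spec (.of k)) := Over.mk (φ ≫ Y.hom)
  let φ' : U' ⟶ Y := Over.homMk φ rfl
  obtain ⟨i'⟩ := i.transfer ((actionBaseChange hp w φ').map (Over.forget _))
    ((actionBaseChange hq w φ').map (Over.forget _))
  obtain ⟨i''⟩ := i'.nonempty_of_forget
  refine ⟨U', φ', ⟨hU, ?_, ?_, ?_⟩, hdom, hqf, het, i''.e, i''.e_snd, ?_⟩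
  · exact inferInstanceAs (IsSeparated (φ ≫ Y.hom))
  · exact inferInstanceAs (LocallyOfFiniteType (φ ≫ Y.hom))
  · exact inferInstanceAs (QuasiCompact (φ ≫ Y.hom))
  · have := epi_whiskerRight w (pullback p φ') hw₁ hw₂
    exact isEquivariant_of_iso hp hq w φ' i''

end Varieties

end GenericEquivalence
theorem mainTheorem2 {k : Type u} [Field k] [IsAlgClosed k]
    (hk : Cardinal.aleph0 ≤ Algebra.trdeg (⊥ : Subfield k) k)
    (S T Y : Over (Spec (.of k)))
    (hS : GenericEquivalence.IsVariety S) (hT : GenericEquivalence.IsVariety T)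
    (hY : GenericEquivalence.IsVariety Y)
    (p : S ⟶ Y) (q : T ⟶ Y) (hp : IsAffineHom p.left) (hq : IsAffineHom q.left) :
    -- Points `y : 𝟙_ _ ⟶ Y` are the `k`-points `Spec k ⟶ Y`, that is, the closed points of `Y`,
    -- and `pullback p y` is the schematic fiber over `y`; all pullbacks are over `Spec k`.
    ((∀ y : 𝟙_ (Over (Spec (.of k))) ⟶ Y, Nonempty (pullback p y ≅ pullback q y)) →
      ∃ (U : Over (Spec (.of k))) (φ : U ⟶ Y), GenericEquivalence.IsVariety U ∧
        IsDominant φ.left ∧ LocallyQuasiFinite φ.left ∧ (CharZero k → Etale φ.left) ∧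
        ∃ e : pullback p φ ≅ pullback q φ, e.hom ≫ pullback.snd q φ = pullback.snd p φ) ∧
    (∀ (G : Over (Spec (.of k))) [GrpObj G] [ModObj G S] [ModObj G T],
      LocallyOfFiniteType G.hom → QuasiCompact G.hom →
      ∀ (hGp : GenericEquivalence.IsInvariant G p) (hGq : GenericEquivalence.IsInvariant G q),
      (∀ y : 𝟙_ (Over (Spec (.of k))) ⟶ Y, ∃ e : pullback p y ≅ pullback q y,
        GenericEquivalence.IsEquivariant G hGp hGq e.hom) →
      ∃ (U : Over (Spec (.of k))) (φ : U ⟶ Y), GenericEquivalence.IsVariety U ∧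
        IsDominant φ.left ∧ LocallyQuasiFinite φ.left ∧ (CharZero k → Etale φ.left) ∧
        ∃ e : pullback p φ ≅ pullback q φ, e.hom ≫ pullback.snd q φ = pullback.snd p φ ∧
          GenericEquivalence.IsEquivariant G hGp hGq e.hom) := by
  have snd_of_point {p : S ⟶ Y} {q : T ⟶ Y} (y : 𝟙_ (Over (Spec (.of k))) ⟶ Y)
      (e : pullback p y ⟶ pullback q y) : e ≫ pullback.snd q y = pullback.snd p y :=
    toUnit_unique _ _
  refine ⟨fun h => ?_, fun G _ _ _ hG hG' hGp hGq h => ?_⟩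
  · -- Actions of the trivial group are projections, so every morphism is equivariant.
    have inv {X : Over (Spec (.of k))} (f : X ⟶ Y) :
        GenericEquivalence.IsInvariant (𝟙_ (Over (Spec (.of k)))) f := by
      have : γ[𝟙_ (Over (Spec (.of k))), X] = snd _ X := leftUnitor_hom X
      rw [GenericEquivalence.IsInvariant, this]
    have act {X : Over (Spec (.of k))} (f : X ⟶ Y) {U : Over (Spec (.of k))} (g : U ⟶ Y) :
        GenericEquivalence.pullbackAct (𝟙_ (Over (Spec (.of k)))) (inv f) g = snd _ _ := by
      have : γ[𝟙_ (Over (Spec (.of k))), X] = snd _ X := leftUnitor_hom X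
      refine pullback.hom_ext ?_ ?_
      · rw [GenericEquivalence.pullbackAct_fst, this, whiskerLeft_snd]
      · rw [GenericEquivalence.pullbackAct_snd]
    have equiv {U : Over (Spec (.of k))} (g : U ⟶ Y) (e : pullback p g ⟶ pullback q g) :
        GenericEquivalence.IsEquivariant (𝟙_ (Over (Spec (.of k)))) (inv p) (inv q) e := by
      rw [GenericEquivalence.IsEquivariant, act, act, whiskerLeft_snd]
    have hid : LocallyOfFiniteType (𝟙_ (Over (Spec (.of k)))).hom :=
      inferInstanceAs (LocallyOfFiniteType (𝟙 _))
    have hid' : QuasiCompact (𝟙_ (Over (Spec (.of k)))).hom :=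
      inferInstanceAs (QuasiCompact (𝟙 _))
    obtain ⟨U, φ, hU, hdom, hqf, het, e, he, -⟩ :=
      GenericEquivalence.exists_equivariant_iso hk hS hT hY hp hq hid hid' (inv p) (inv q)
        fun y => (h y).elim fun e => ⟨e, snd_of_point y e.hom, equiv y e.hom⟩
    exact ⟨U, φ, hU, hdom, hqf, het, e, he⟩
  · exact GenericEquivalence.exists_equivariant_iso hk hS hT hY hp hq hG hG' hGp hGq fun y =>
      (h y).imp fun e he => ⟨snd_of_point y e.hom, he⟩
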